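/- Let $s\ge 2$ be an integer. There is a function $\delta_s\colon(0,1]\to[0,\infty)$, depending only on $s$, with $\delta_s(\eta)\to 0$ as $\eta\to 0^+$, such that the following holds. For a nonempty finite set $V$, an even integer $\ell\ge 2$ and $G\colon V^s\to\mathbb{R}$, define the $\ell$-box norm $$\|G\|_{\square_\ell(V^s)}=\Bigl(\frac{1}{|V|^{s\ell}}\sum_{x=(x_{ij})\in V^{s\times \ell}}\ \prod_{\omega\in\{1,\dots,\ell\}^s} G\bigl(x_{1\omega_1},\dots,x_{s\omega_s}\bigr)\Bigr)^{1/\ell^s},$$ and let $\|G\|_{\square(V^s)}=\|G\|_{\square_2(V^s)}$ be the box norm. Let $V$ be a nonempty finite set, let $0<\eta\le 1$, and let $\nu\colon V^s\to[0,\infty)$ satisfy $\|\nu-1\|_{\square_4(V^s)}\le\eta$. Then for every $F\colon V^s\to\mathbb{R}$ with $|F|\le\nu$ pointwise there exists $H\colon V^s\to[-1,1]$ such that $$\|F-H\|_{\square(V^s)}\le\delta_s(\eta).$$ Moreover, if $F$ is nonnegative, then $H$ can also be taken nonnegative (so $H\colon V^s\to[0,1]$). -/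

import Mathlib

universe u

open Filter Topology
open scoped BigOperators

/-- For `ω ∈ [ℓ]^s`, the projection `π_ω : V^{s × ℓ} → V^s`, `π_ω((x_{ij})) = (x_{i ω_i})_i`. -/
def boxProj {V : Type*} {s ℓ : ℕ} (ω : Fin s → Fin ℓ) (x : Fin s → Fin ℓ → V) : Fin s → V :=
  fun i => x i (ω i)

/-- The `ℓ`-box norm of `F : V^s → ℝ`, for an even integer `ℓ ≥ 2`: the `ℓ^s`-th root of the average
over `x ∈ V^{s × ℓ}` of `∏_{ω ∈ [ℓ]^s} F (π_ω x)` (this average is nonnegative for even `ℓ`). -/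
noncomputable def lBoxNorm (ℓ : ℕ) {V : Type*} [Fintype V] {s : ℕ} (F : (Fin s → V) → ℝ) : ℝ :=
  (𝔼 x : Fin s → Fin ℓ → V, ∏ ω : Fin s → Fin ℓ, F (boxProj ω x)) ^ (1 / (ℓ : ℝ) ^ s)

/-- The box norm of `F : V^s → ℝ`, that is, the `ℓ`-box norm for `ℓ = 2`. -/
noncomputable def boxNorm {V : Type*} [Fintype V] {s : ℕ} (F : (Fin s → V) → ℝ) : ℝ :=
  lBoxNorm 2 F

/-! The test functions are products of 1-bounded functions whose i-th factor ignores coordinate i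
(`cutFunctions`); averages against them define a cut norm. Three facts combine.

Forms with factors `1`, `ν` or `ν - 1`, at least one of them `ν - 1`, are small: expand `ν = 1 + (ν
- 1)` and apply Gowers–Cauchy–Schwarz for the 4-box norm. One Cauchy–Schwarz step per coordinate
then lets the other factors be arbitrary functions bounded by `1` or `ν`
(`abs_boxForm_four_le_vonNeumannErr`). In particular `ν - 1` is small in cut norm.

Minimax and a polynomial approximation of the positive part turn this into a bounded `H` with `F -
H` small in cut norm (`exists_denseModel`).

Cut-norm smallness implies box-norm smallness by densification (`abs_boxForm_two_le_countErr`). The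
average of `f` against its dual function `D` is bounded, by Cauchy–Schwarz, through the average of
`ν * D ^ 2`. There `ν` may be dropped by the first fact, and one `D` truncated because the dual
function of the majorant concentrates near 1. This trades one copy of `f` for a bounded function;
with a single copy left, the form is an average of cut-norm tests. -/

/-! ### Averages over product spaces -/

section Averages

variable {ι κ V : Type*}

/-- Resampling one coordinate does not change an average. -/
theorem expect_update [Fintype ι] [DecidableEq ι] [Fintype V] [Nonempty V] (i : ι)
    (f : (ι → V) → ℝ) : 𝔼 x, f x = 𝔼 x : ι → V, 𝔼 z : V, f (Function.update x i z) := by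
  have h1 : 𝔼 p : (ι → V) × V, f p.1 = 𝔼 x, f x := by
    rw [← Finset.univ_product_univ, Finset.expect_product]
    simp
  have h2 : 𝔼 p : (ι → V) × V, f (Function.update p.1 i p.2)
      = 𝔼 x : ι → V, 𝔼 z : V, f (Function.update x i z) := by
    rw [← Finset.univ_product_univ, Finset.expect_product]
  rw [← h1, ← h2]
  have hinv : Function.Involutive
      (fun p : (ι → V) × V => ((Function.update p.1 i p.2, p.1 i) : (ι → V) × V)) := by
    intro p
    simp
  refine (Fintype.expect_bijective _ hinv.bijective _ _ fun p => ?_).symm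
  rfl

/-- The average of a product of functions of independent variables factors. -/
theorem expect_pi_prod [Fintype κ] [DecidableEq κ] [Fintype V] (b : κ → V → ℝ) :
    𝔼 z : κ → V, ∏ k, b k (z k) = ∏ k, 𝔼 v, b k v := by
  simp only [Fintype.expect_eq_sum_div_card, Finset.prod_div_distrib, Finset.prod_univ_sum,
    Fintype.piFinset_univ]
  simp

theorem expect_prod_type [Fintype ι] [Fintype κ] (f : ι → κ → ℝ) :
    𝔼 p : ι × κ, f p.1 p.2 = 𝔼 x, 𝔼 y, f x y := by
  rw [← Finset.univ_product_univ, Finset.expect_product]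

end Averages

/-! ### Box forms, Gowers–Cauchy–Schwarz and the linear forms condition -/

section BoxForm

variable {V : Type*} [Fintype V] {s ℓ : ℕ}

/-- The multilinear form behind the `ℓ`-box norm. -/
noncomputable def boxForm (ℓ : ℕ) {V : Type*} [Fintype V] {s : ℕ}
    (h : (Fin s → Fin ℓ) → (Fin s → V) → ℝ) : ℝ :=
  𝔼 x : Fin s → Fin ℓ → V, ∏ ω, h ω (boxProj ω x)

/-- The contribution to `boxForm` of the indices `ω` with `ω i = k`, averaged over the
variable `x i k`. -/
noncomputable def boxSlice (h : (Fin s → Fin ℓ) → (Fin s → V) → ℝ) (i : Fin s) (k : Fin ℓ)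
    (x : Fin s → Fin ℓ → V) : ℝ :=
  𝔼 v : V, ∏ ω with ω i = k, h ω (boxProj ω (Function.update x i fun _ => v))

/-- With the other rows fixed, the factor at `ω` sees row `i` only through the entry `x i (ω i)`, so
the groups with different `ω i` are independent. -/
theorem boxForm_eq_expect_prod_boxSlice [Nonempty V] (h : (Fin s → Fin ℓ) → (Fin s → V) → ℝ)
    (i : Fin s) : boxForm ℓ h = 𝔼 x, ∏ k, boxSlice h i k x := by
  have : Nonempty (Fin ℓ → V) := ⟨fun _ => Classical.arbitrary V⟩
  rw [boxForm, expect_update i]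
  refine Finset.expect_congr rfl fun x _ => ?_
  unfold boxSlice
  rw [← expect_pi_prod
    fun k v => ∏ ω with ω i = k, h ω (boxProj ω (Function.update x i fun _ => v))]
  refine Finset.expect_congr rfl fun z _ => ?_
  rw [← Finset.prod_fiberwise (s := Finset.univ) (g := fun ω : Fin s → Fin ℓ => ω i)]
  refine Finset.prod_congr rfl fun k _ => Finset.prod_congr rfl fun ω hω => ?_
  have hk : ω i = k := by simpa using hω
  congr 1
  funext j
  by_cases hj : j = i
  · subst hj; simp [boxProj, hk]
  · simp [boxProj, hj]

theorem boxSlice_congr {h h' : (Fin s → Fin ℓ) → (Fin s → V) → ℝ} {i : Fin s} {k : Fin ℓ}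
    (hh : ∀ ω, ω i = k → h ω = h' ω) (x : Fin s → Fin ℓ → V) :
    boxSlice h i k x = boxSlice h' i k x := by
  refine Finset.expect_congr rfl fun v _ => Finset.prod_congr rfl fun ω hω => ?_
  rw [hh ω (by simpa using hω)]

/-- A slice is evaluated on a constant row `i`, so only the family depends on `ω i`. Thus powers of
one slice are again box forms, which makes Hölder and Cauchy–Schwarz iterable. -/
theorem boxSlice_update (h : (Fin s → Fin ℓ) → (Fin s → V) → ℝ) (i : Fin s) (k k' : Fin ℓ)
    (x : Fin s → Fin ℓ → V) :
    boxSlice (fun ω => h (Function.update ω i k)) i k' x = boxSlice h i k x := by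
  refine Finset.expect_congr rfl fun v _ => ?_
  refine Finset.prod_nbij' (fun ω => Function.update ω i k) (fun ω => Function.update ω i k')
    ?_ ?_ ?_ ?_ ?_
  · simp
  · simp
  · intro ω hω
    have : ω i = k' := by simpa using hω
    simp [← this]
  · intro ω hω
    have : ω i = k := by simpa using hω
    simp [← this]
  · intro ω _
    congr 1
    funext j
    by_cases hj : j = i
    · subst hj; simp [boxProj]
    · simp [boxProj, hj]

theorem boxSlice_one [Nonempty V] {h : (Fin s → Fin ℓ) → (Fin s → V) → ℝ} {i : Fin s} {k : Fin ℓ}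
    (hh : ∀ ω, ω i = k → h ω = 1) (x : Fin s → Fin ℓ → V) : boxSlice h i k x = 1 := by
  rw [boxSlice_congr (h' := fun _ => 1) hh]
  simp [boxSlice]

theorem abs_boxSlice_le {h w : (Fin s → Fin ℓ) → (Fin s → V) → ℝ} {i : Fin s} {k : Fin ℓ}
    (hh : ∀ ω, ω i = k → ∀ v, |h ω v| ≤ w ω v) (x : Fin s → Fin ℓ → V) :
    |boxSlice h i k x| ≤ boxSlice w i k x := by
  refine (Finset.abs_expect_le _ _).trans (Finset.expect_le_expect fun v _ => ?_)
  rw [Finset.abs_prod]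
  exact Finset.prod_le_prod (fun _ _ => abs_nonneg _)
    fun ω hω => hh ω (by simpa using hω) _

/-- A four-fold Hölder inequality in additive form. -/
theorem abs_boxForm_four_le [Nonempty V] (h : (Fin s → Fin 4) → (Fin s → V) → ℝ) (i : Fin s) :
    |boxForm 4 h| ≤ (∑ k : Fin 4, boxForm 4 fun ω => h (Function.update ω i k)) / 4 := by
  simp only [boxForm_eq_expect_prod_boxSlice _ i, boxSlice_update]
  rw [← Finset.expect_sum_comm, Finset.expect_div]
  refine (Finset.abs_expect_le _ _).trans (Finset.expect_le_expect fun x _ => ?_)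
  simp only [Fin.prod_univ_four, Fin.sum_univ_four]
  generalize boxSlice h i 0 x = a, boxSlice h i 1 x = b, boxSlice h i 2 x = c,
    boxSlice h i 3 x = d
  -- AM–GM: `|abcd| ≤ (a⁴ + b⁴ + c⁴ + d⁴) / 4`.
  rw [abs_le]
  constructor <;> nlinarith [sq_nonneg (a * b + c * d), sq_nonneg (a * b - c * d),
    sq_nonneg (a * a - b * b), sq_nonneg (c * c - d * d)]

/-- For a constant family the four-fold inequality bounds an absolute value by the form itself. -/
theorem boxForm_four_const_nonneg [Nonempty V] (hs : 0 < s) (F : (Fin s → V) → ℝ) :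
    0 ≤ boxForm 4 (fun _ => F) := by
  have := (abs_nonneg _).trans (abs_boxForm_four_le (fun _ => F) ⟨0, hs⟩)
  simp only [Fin.sum_univ_four] at this
  linarith

/-- Gowers–Cauchy–Schwarz for the `4`-box norm, in normalized form. -/
theorem abs_boxForm_four_le_one [Nonempty V] (hs : 0 < s)
    (h : (Fin s → Fin 4) → (Fin s → V) → ℝ) (hh : ∀ ω₀, boxForm 4 (fun _ => h ω₀) ≤ 1) :
    |boxForm 4 h| ≤ 1 := by
  -- Freeze the coordinates in `I` one at a time; once all are frozen the family is constant.
  have key : ∀ (I : Finset (Fin s)) (h : (Fin s → Fin 4) → (Fin s → V) → ℝ),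
      (∀ ω₀, |boxForm 4 (fun ω => h (I.piecewise ω₀ ω))| ≤ 1) → |boxForm 4 h| ≤ 1 := by
    intro I
    induction I using Finset.induction_on with
    | empty => intro h hh; simpa using hh 0
    | insert i I hi ih =>
      intro h hh
      refine (abs_boxForm_four_le h i).trans ?_
      have : ∀ k : Fin 4, boxForm 4 (fun ω => h (Function.update ω i k)) ≤ 1 := by
        intro k
        refine (le_abs_self _).trans (ih _ fun ω₀ => ?_)
        convert hh (Function.update ω₀ i k) using 3
        funext ω
        congr 1
        funext j
        by_cases hj : j = i
        · subst hj; simp [Finset.piecewise]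
        · by_cases hj' : j ∈ I <;> simp [Finset.piecewise, hj, hj']
      have h4 := Finset.sum_le_sum fun k (_ : k ∈ Finset.univ) => this k
      simp at h4
      linarith
  refine key Finset.univ h fun ω₀ => ?_
  simp only [Finset.piecewise_univ]
  rw [abs_of_nonneg (boxForm_four_const_nonneg hs _)]
  exact hh ω₀

theorem boxForm_const_one [Nonempty V] : boxForm ℓ (fun _ => (1 : (Fin s → V) → ℝ)) = 1 := by
  simp [boxForm]

theorem lBoxNorm_eq (F : (Fin s → V) → ℝ) :
    lBoxNorm ℓ F = boxForm ℓ (fun _ => F) ^ (1 / (ℓ : ℝ) ^ s) := rfl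

theorem boxForm_four_le_of_lBoxNorm_le [Nonempty V] (hs : 0 < s) {F : (Fin s → V) → ℝ} {η : ℝ}
    (hF : lBoxNorm 4 F ≤ η) : boxForm 4 (fun _ => F) ≤ η ^ 4 ^ s := by
  have h0 := boxForm_four_const_nonneg hs F
  rw [lBoxNorm_eq] at hF
  have h1 := pow_le_pow_left₀ (Real.rpow_nonneg h0 _) hF (4 ^ s)
  rw [← Real.rpow_natCast, ← Real.rpow_mul h0] at h1
  simpa using h1

/-- The form on copies of `F` at the indices in a nonempty set `T`. -/
theorem abs_boxForm_four_ite_le [Nonempty V] (hs : 0 < s) {F : (Fin s → V) → ℝ} {η : ℝ}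
    (hη : 0 < η) (hη1 : η ≤ 1) (hF : lBoxNorm 4 F ≤ η) (T : Finset (Fin s → Fin 4))
    (hT : T.Nonempty) : |boxForm 4 (fun ω => if ω ∈ T then F else 1)| ≤ η := by
  have hF4 := boxForm_four_le_of_lBoxNorm_le hs hF
  -- Rescaling normalizes the constant forms to at most 1; undoing it gains `η ^ T.card ≤ η`.
  set h : (Fin s → Fin 4) → (Fin s → V) → ℝ := fun ω => if ω ∈ T then η⁻¹ • F else 1 with hh
  have h1 : |boxForm 4 h| ≤ 1 := by
    refine abs_boxForm_four_le_one hs h fun ω₀ => ?_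
    by_cases hω : ω₀ ∈ T
    · have : boxForm 4 (fun _ => h ω₀) = (η⁻¹) ^ 4 ^ s * boxForm 4 (fun _ => F) := by
        simp only [boxForm, hh, hω, if_true, Finset.mul_expect]
        refine Finset.expect_congr rfl fun x _ => ?_
        simp [Finset.prod_mul_distrib]
      rw [this, inv_pow, inv_mul_le_iff₀ (by positivity), mul_one]
      exact hF4
    · simp only [hh, hω, if_false]
      exact boxForm_const_one.le
  have h2 : boxForm 4 (fun ω => if ω ∈ T then F else 1) = η ^ T.card * boxForm 4 h := by
    simp only [boxForm, Finset.mul_expect]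
    refine Finset.expect_congr rfl fun x _ => ?_
    have e1 : ∀ (G : (Fin s → V) → ℝ), ∏ ω, (if ω ∈ T then G else 1) (boxProj ω x)
        = ∏ ω ∈ T, G (boxProj ω x) := by
      intro G
      rw [← Finset.prod_filter_mul_prod_filter_not Finset.univ (· ∈ T)]
      rw [Finset.prod_eq_one (s := Finset.univ.filter fun ω => ω ∉ T)]
      · rw [mul_one]
        refine Finset.prod_congr (by ext; simp) fun ω hω => by rw [if_pos hω]
      · intro ω hω
        rw [if_neg (by simpa using hω)]; rfl
    rw [e1, hh]
    simp only [e1, Pi.smul_apply, smul_eq_mul, Finset.prod_mul_distrib, Finset.prod_const]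
    rw [← mul_assoc, ← mul_pow, mul_inv_cancel₀ hη.ne', one_pow, one_mul]
  rw [h2, abs_mul, abs_of_pos (by positivity)]
  calc η ^ T.card * |boxForm 4 h| ≤ η ^ T.card * 1 := by gcongr
    _ ≤ η := by rw [mul_one]; exact pow_le_of_le_one hη.le hη1 (by simpa using hT.ne_empty)

/-- Expanding the factors `ν = 1 + (ν - 1)` of a form. -/
theorem boxForm_expand (ν : (Fin s → V) → ℝ) (T₀ T : Finset (Fin s → Fin ℓ))
    (hd : Disjoint T₀ T) :
    boxForm ℓ (fun ω => if ω ∈ T₀ then fun v => ν v - 1 else if ω ∈ T then ν else 1)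
      = ∑ U ∈ T.powerset, boxForm ℓ (fun ω => if ω ∈ T₀ ∪ U then fun v => ν v - 1 else 1) := by
  unfold boxForm
  rw [← Finset.expect_sum_comm]
  refine Finset.expect_congr rfl fun x _ => ?_
  have e1 : ∀ U : Finset (Fin s → Fin ℓ),
      ∏ ω, (if ω ∈ U then fun v => ν v - 1 else (1 : (Fin s → V) → ℝ)) (boxProj ω x)
        = ∏ ω ∈ U, (ν (boxProj ω x) - 1) := by
    intro U
    rw [← Finset.prod_subset (Finset.subset_univ U)]
    · exact Finset.prod_congr rfl fun ω hω => by rw [if_pos hω]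
    · intro ω _ hω
      rw [if_neg hω]; rfl
  simp only [e1]
  have e2 : ∀ U ∈ T.powerset, ∏ ω ∈ T₀ ∪ U, (ν (boxProj ω x) - 1)
      = (∏ ω ∈ T₀, (ν (boxProj ω x) - 1)) * ∏ ω ∈ U, (ν (boxProj ω x) - 1) := fun U hU =>
    Finset.prod_union (hd.mono_right (Finset.mem_powerset.1 hU))
  rw [Finset.sum_congr rfl e2, ← Finset.mul_sum, ← Finset.prod_one_add,
    ← Finset.prod_subset (Finset.subset_univ (T₀ ∪ T)), Finset.prod_union hd]
  · congr 1
    · exact Finset.prod_congr rfl fun ω hω => by rw [if_pos hω]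
    · refine Finset.prod_congr rfl fun ω hω => ?_
      rw [if_neg (fun h => Finset.disjoint_left.1 hd h hω), if_pos hω]; ring
  · intro ω _ hω
    simp only [Finset.mem_union, not_or] at hω
    rw [if_neg hω.1, if_neg hω.2]; rfl

/-- The number of sets of indices in `[4]^s`. -/
noncomputable def linearFormsConst (s : ℕ) : ℝ := 2 ^ 4 ^ s

theorem linearFormsConst_pos (s : ℕ) : 0 < linearFormsConst s := by
  unfold linearFormsConst; positivity

theorem card_powerset_le (T : Finset (Fin s → Fin 4)) :
    (T.powerset.card : ℝ) ≤ linearFormsConst s := by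
  rw [Finset.card_powerset, linearFormsConst]
  have : T.card ≤ 4 ^ s := by simpa using T.card_le_univ
  push_cast
  exact pow_le_pow_right₀ (by norm_num) this

variable [Nonempty V] {ν : (Fin s → V) → ℝ} {η : ℝ}

/-- The linear forms condition, with at least one factor `ν - 1`. -/
theorem abs_boxForm_four_sub_one_le (hs : 0 < s) (hη : 0 < η) (hη1 : η ≤ 1)
    (hν : lBoxNorm 4 (fun v => ν v - 1) ≤ η) {T₀ T : Finset (Fin s → Fin 4)}
    (hd : Disjoint T₀ T) (hT₀ : T₀.Nonempty) :
    |boxForm 4 (fun ω => if ω ∈ T₀ then fun v => ν v - 1 else if ω ∈ T then ν else 1)|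
      ≤ linearFormsConst s * η := by
  rw [boxForm_expand _ _ _ hd]
  refine (Finset.abs_sum_le_sum_abs _ _).trans ?_
  refine (Finset.sum_le_card_nsmul _ _ η fun U _ => ?_).trans ?_
  · exact abs_boxForm_four_ite_le hs hη hη1 hν _ (hT₀.mono Finset.subset_union_left)
  · rw [nsmul_eq_mul]
    exact mul_le_mul_of_nonneg_right (card_powerset_le T) hη.le

/-- The linear forms condition. -/
theorem abs_boxForm_four_measure_sub_one_le (hs : 0 < s) (hη : 0 < η) (hη1 : η ≤ 1)
    (hν : lBoxNorm 4 (fun v => ν v - 1) ≤ η) (T : Finset (Fin s → Fin 4)) :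
    |boxForm 4 (fun ω => if ω ∈ T then ν else 1) - 1| ≤ linearFormsConst s * η := by
  have h := boxForm_expand ν ∅ T (Finset.disjoint_empty_left _)
  simp only [Finset.notMem_empty, if_false, Finset.empty_union] at h
  rw [h, ← Finset.add_sum_erase _ _ (Finset.empty_mem_powerset T)]
  simp only [Finset.notMem_empty, if_false, boxForm_const_one, add_sub_cancel_left]
  refine (Finset.abs_sum_le_sum_abs _ _).trans ?_
  refine (Finset.sum_le_card_nsmul _ _ η fun U hU => ?_).trans ?_
  · exact abs_boxForm_four_ite_le hs hη hη1 hν _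
      (Finset.nonempty_iff_ne_empty.2 (Finset.ne_of_mem_erase hU))
  · rw [nsmul_eq_mul]
    refine mul_le_mul_of_nonneg_right (le_trans ?_ (card_powerset_le T)) hη.le
    exact_mod_cast Finset.card_le_card (Finset.erase_subset _ _)

end BoxForm

/-! ### The generalized von Neumann inequality -/

section VonNeumann

variable {V : Type*} [Fintype V] [Nonempty V] {s : ℕ}

/-- One Cauchy–Schwarz step in coordinate `j`, with weights `w`. -/
theorem boxForm_four_sq_le (j : Fin s) {h w : (Fin s → Fin 4) → (Fin s → V) → ℝ}
    (h1 : ∀ ω, ω j = 1 → h ω = 1)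
    (hw : ∀ ω, ω j ≠ 0 → ω j ≠ 1 → ∀ v, |h ω v| ≤ w ω v) :
    boxForm 4 h ^ 2 ≤ boxForm 4 (fun ω => if ω j = 0 ∨ ω j = 1 then 1 else w ω) *
      boxForm 4 (fun ω => if ω j = 0 ∨ ω j = 1 then h (Function.update ω j 0) else w ω) := by
  simp only [boxForm_eq_expect_prod_boxSlice _ j, Fin.prod_univ_four]
  have b1 : ∀ x, boxSlice h j 1 x = 1 := boxSlice_one h1
  have c0 : ∀ x, boxSlice (fun ω => if ω j = 0 ∨ ω j = 1 then 1 else w ω) j 0 x = 1 :=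
    boxSlice_one fun ω hω => by simp [hω]
  have c1 : ∀ x, boxSlice (fun ω => if ω j = 0 ∨ ω j = 1 then 1 else w ω) j 1 x = 1 :=
    boxSlice_one fun ω hω => by simp [hω]
  have c23 : ∀ (H : (Fin s → Fin 4) → (Fin s → V) → ℝ) (k : Fin 4), k ≠ 0 → k ≠ 1 → ∀ x,
      boxSlice (fun ω => if ω j = 0 ∨ ω j = 1 then H ω else w ω) j k x = boxSlice w j k x :=
    fun H k hk0 hk1 => boxSlice_congr fun ω hω => by simp [hω, hk0, hk1]
  have d01 : ∀ k : Fin 4, k = 0 ∨ k = 1 → ∀ x,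
      boxSlice (fun ω => if ω j = 0 ∨ ω j = 1 then h (Function.update ω j 0) else w ω) j k x
        = boxSlice h j 0 x := fun k hk x => by
    rw [← boxSlice_update h j 0 k x]
    exact boxSlice_congr (fun ω hω => by simp [hω, hk]) x
  have b23 : ∀ k : Fin 4, k ≠ 0 → k ≠ 1 → ∀ x, |boxSlice h j k x| ≤ boxSlice w j k x :=
    fun k hk0 hk1 => abs_boxSlice_le fun ω hω => hw ω (hω ▸ hk0) (hω ▸ hk1)
  simp only [b1, c0, c1, c23 _ 2 (by decide) (by decide), c23 _ 3 (by decide) (by decide),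
    d01 0 (Or.inl rfl), d01 1 (Or.inr rfl), mul_one, one_mul]
  have w2 : ∀ x, 0 ≤ boxSlice w j 2 x := fun x =>
    (abs_nonneg _).trans (b23 2 (by decide) (by decide) x)
  have w3 : ∀ x, 0 ≤ boxSlice w j 3 x := fun x =>
    (abs_nonneg _).trans (b23 3 (by decide) (by decide) x)
  -- Slices 2 and 3 are replaced by their weights, split as square roots for Cauchy–Schwarz. The
  -- resulting square of slice 0 fits into the form because slot 1 was empty.
  have step1 : |𝔼 x, boxSlice h j 0 x * boxSlice h j 2 x * boxSlice h j 3 x|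
      ≤ 𝔼 x, √(boxSlice w j 2 x * boxSlice w j 3 x) *
        (√(boxSlice w j 2 x * boxSlice w j 3 x) * |boxSlice h j 0 x|) := by
    refine (Finset.abs_expect_le _ _).trans (Finset.expect_le_expect fun x _ => ?_)
    rw [← mul_assoc, Real.mul_self_sqrt (mul_nonneg (w2 x) (w3 x)), abs_mul, abs_mul, mul_assoc,
      mul_comm]
    gcongr
    · exact w2 x
    · exact b23 2 (by decide) (by decide) x
    · exact b23 3 (by decide) (by decide) x
  rw [← sq_abs]
  refine (pow_le_pow_left₀ (abs_nonneg _) step1 2).trans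
    ((Finset.expect_mul_sq_le_sq_mul_sq _ _ _).trans (le_of_eq ?_))
  congr 1 <;> refine Finset.expect_congr rfl fun x _ => ?_
  · exact Real.sq_sqrt (mul_nonneg (w2 x) (w3 x))
  · rw [mul_pow, Real.sq_sqrt (mul_nonneg (w2 x) (w3 x)), sq_abs]
    ring

/-- The error after `k` Cauchy–Schwarz steps. -/
noncomputable def vonNeumannErr : ℕ → ℝ → ℝ
  | 0, t => t
  | k + 1, t => √(2 * vonNeumannErr k t)

theorem continuous_vonNeumannErr (k : ℕ) : Continuous (vonNeumannErr k) := by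
  induction k with
  | zero => exact continuous_id
  | succ k ih => exact Real.continuous_sqrt.comp (continuous_const.mul ih)

theorem vonNeumannErr_zero (k : ℕ) : vonNeumannErr k 0 = 0 := by
  induction k with
  | zero => rfl
  | succ k ih => simp [vonNeumannErr, ih]

theorem vonNeumannErr_nonneg (k : ℕ) {t : ℝ} (ht : 0 ≤ t) : 0 ≤ vonNeumannErr k t := by
  cases k with
  | zero => exact ht
  | succ k => exact Real.sqrt_nonneg _

variable {ν : (Fin s → V) → ℝ} {η : ℝ}

/-- The linear forms condition for a family of factors each equal to `1` or `ν`. -/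
theorem abs_boxForm_four_sub_one_le_of_eq (hs : 0 < s) (hη : 0 < η) (hη1 : η ≤ 1)
    (hν : lBoxNorm 4 (fun v => ν v - 1) ≤ η) (p : (Fin s → Fin 4) → (Fin s → V) → ℝ)
    (hp : ∀ ω, p ω = 1 ∨ p ω = ν) : |boxForm 4 p - 1| ≤ linearFormsConst s * η := by
  classical
  have e : p = fun ω => if ω ∈ Finset.univ.filter (fun ω => p ω = ν) then ν else 1 := by
    funext ω
    split_ifs with h
    · exact (Finset.mem_filter.1 h).2
    · exact (hp ω).resolve_right fun h' => h (by simp [h'])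
  rw [e]
  exact abs_boxForm_four_measure_sub_one_le hs hη hη1 hν _

/-- Partially processed form of the generalized von Neumann inequality: the coordinates in `I`
have already been doubled. -/
theorem abs_boxForm_four_le_of_processed (hs : 0 < s) (hη : 0 < η) (hη1 : η ≤ 1)
    (hCη : linearFormsConst s * η ≤ 1)
    (hν : lBoxNorm 4 (fun v => ν v - 1) ≤ η) (k : ℕ) :
    ∀ (I : Finset (Fin s)) (h : (Fin s → Fin 4) → (Fin s → V) → ℝ), Iᶜ.card = k →
      (∀ ω, (∀ j ∈ I, ω j = 0 ∨ ω j = 1) → (∀ j ∉ I, ω j = 0) → h ω = fun v => ν v - 1) →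
      (∀ ω, (∃ j ∉ I, ω j = 1) → h ω = 1) →
      (∀ ω, (∃ j ∈ I, ω j ≠ 0 ∧ ω j ≠ 1) → h ω = 1 ∨ h ω = ν) →
      (∀ ω, (∃ j, ω j ≠ 0 ∧ ω j ≠ 1) → (∀ v, |h ω v| ≤ 1) ∨ ∀ v, |h ω v| ≤ ν v) →
      |boxForm 4 h| ≤ vonNeumannErr k (linearFormsConst s * η) := by
  classical
  have hC := linearFormsConst_pos s
  -- The invariants: `ν - 1` sits at the indices that are 0 or 1 on `I` and 0 elsewhere; value 1 at
  -- an unprocessed coordinate is still free; value 2 or 3 at a processed coordinate means a factor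
  -- exactly `1` or `ν`; any index with a value 2 or 3 has a factor bounded by `1` or `ν`.
  induction k with
  | zero =>
    intro I h hI ha _ hc _
    have hI : I = Finset.univ := by simpa using hI
    subst hI
    have hh : h = fun ω => if ω ∈ Finset.univ.filter (fun ω => ∀ j, ω j = 0 ∨ ω j = 1)
        then fun v => ν v - 1 else if ω ∈ Finset.univ.filter
          (fun ω => (¬ ∀ j, ω j = 0 ∨ ω j = 1) ∧ h ω = ν) then ν else 1 := by
      funext ω
      split_ifs with hω hω'
      · exact ha ω (fun j _ => by simpa using (Finset.mem_filter.1 hω).2 j) (by simp)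
      · exact (Finset.mem_filter.1 hω').2.2
      · simp only [Finset.mem_filter, Finset.mem_univ, true_and] at hω hω'
        have : ¬ h ω = ν := fun e => hω' ⟨hω, e⟩
        push Not at hω
        exact (hc ω (by simpa using hω)).resolve_right this
    rw [hh]
    refine abs_boxForm_four_sub_one_le hs hη hη1 hν ?_ ⟨fun _ => 0, by simp⟩
    rw [Finset.disjoint_left]
    intro ω hω hω'
    exact (Finset.mem_filter.1 hω').2.1 (Finset.mem_filter.1 hω).2
  | succ k ih =>
    intro I h hI ha hb hc hd
    obtain ⟨j, hj⟩ : Iᶜ.Nonempty := by rw [← Finset.card_pos]; omega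
    have hjI : j ∉ I := by simpa using hj
    set w : (Fin s → Fin 4) → (Fin s → V) → ℝ := fun ω => if ∀ v, |h ω v| ≤ 1 then 1 else ν
      with hw
    have hwor : ∀ ω, w ω = 1 ∨ w ω = ν := fun ω => by simp only [hw]; split_ifs <;> simp
    have hstep := boxForm_four_sq_le (w := w) j (fun ω hω => hb ω ⟨j, hjI, hω⟩)
      (fun ω h0 h1 v => by
        simp only [hw]
        split_ifs with hω
        · exact hω v
        · exact (hd ω ⟨j, h0, h1⟩).resolve_left hω v)
    -- The weight form differs from 1 by at most `linearFormsConst s * η ≤ 1`; this is the 2 in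
    -- `vonNeumannErr`.
    have hW : 0 ≤ boxForm 4 (fun ω => if ω j = 0 ∨ ω j = 1 then 1 else w ω) ∧
        boxForm 4 (fun ω => if ω j = 0 ∨ ω j = 1 then 1 else w ω) ≤ 2 := by
      have := abs_le.1 (abs_boxForm_four_sub_one_le_of_eq hs hη hη1 hν
        (fun ω => if ω j = 0 ∨ ω j = 1 then 1 else w ω) fun ω => by
          split_ifs
          exacts [Or.inl rfl, hwor ω])
      constructor <;> linarith [this.1, this.2]
    have hnext := ih (insert j I)
      (fun ω => if ω j = 0 ∨ ω j = 1 then h (Function.update ω j 0) else w ω)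
      (by
        rw [Finset.compl_insert, Finset.card_erase_of_mem hj]; omega)
      (fun ω h1 h2 => by
        rw [if_pos (h1 j (Finset.mem_insert_self _ _))]
        refine ha _ (fun i hi => ?_) (fun i hi => ?_)
        · rw [Function.update_of_ne (by rintro rfl; exact hjI hi)]
          exact h1 i (Finset.mem_insert_of_mem hi)
        · by_cases hij : i = j
          · subst hij; simp
          · rw [Function.update_of_ne hij]
            exact h2 i (by simp [hij, hi]))
      (fun ω ⟨i, hi, hi1⟩ => by
        simp only [Finset.mem_insert, not_or] at hi
        split_ifs with hω
        · exact hb _ ⟨i, hi.2, by rw [Function.update_of_ne hi.1, hi1]⟩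
        · have : h ω = 1 := hb _ ⟨i, hi.2, hi1⟩
          simp [hw, this])
      (fun ω ⟨i, hi, hi1⟩ => by
        split_ifs with hω
        · have hij : i ≠ j := by rintro rfl; exact hω.elim hi1.1 hi1.2
          exact hc _ ⟨i, (Finset.mem_insert.1 hi).resolve_left hij, by
            rwa [Function.update_of_ne hij]⟩
        · exact hwor ω)
      (fun ω ⟨i, hi1⟩ => by
        split_ifs with hω
        · have hij : i ≠ j := by rintro rfl; exact hω.elim hi1.1 hi1.2
          exact hd _ ⟨i, by rwa [Function.update_of_ne hij]⟩
        · rcases hwor ω with e | e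
          · exact Or.inl fun v => by simp [e]
          · rcases hd ω ⟨j, by simpa [not_or] using hω⟩ with h1 | h1
            · left
              intro v
              simp [hw, h1]
            · right
              intro v
              rw [e, abs_of_nonneg ((abs_nonneg _).trans (h1 v))])
    set N := boxForm 4 (fun ω => if ω j = 0 ∨ ω j = 1 then h (Function.update ω j 0) else w ω)
    set M := boxForm 4 (fun ω => if ω j = 0 ∨ ω j = 1 then 1 else w ω)
    have hE := vonNeumannErr_nonneg k (mul_nonneg hC.le hη.le)
    refine Real.abs_le_sqrt (hstep.trans ?_)
    calc M * N ≤ M * vonNeumannErr k (linearFormsConst s * η) := by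
          gcongr
          · exact hW.1
          exact (le_abs_self _).trans hnext
      _ ≤ 2 * vonNeumannErr k (linearFormsConst s * η) := by gcongr; exact hW.2

/-- The generalized von Neumann inequality for `ν - 1`, with the other factors bounded
by `1` or by `ν`. -/
theorem abs_boxForm_four_le_vonNeumannErr (hs : 0 < s) (hη : 0 < η) (hη1 : η ≤ 1)
    (hCη : linearFormsConst s * η ≤ 1) (hν : lBoxNorm 4 (fun v => ν v - 1) ≤ η)
    (h : (Fin s → Fin 4) → (Fin s → V) → ℝ) (h0 : h 0 = fun v => ν v - 1)
    (h1 : ∀ ω, (∃ j, ω j = 1) → h ω = 1)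
    (h2 : ∀ ω, (∃ j, ω j ≠ 0 ∧ ω j ≠ 1) → (∀ v, |h ω v| ≤ 1) ∨ ∀ v, |h ω v| ≤ ν v) :
    |boxForm 4 h| ≤ vonNeumannErr s (linearFormsConst s * η) := by
  refine abs_boxForm_four_le_of_processed hs hη hη1 hCη hν s ∅ h (by simp) ?_ ?_ ?_ h2
  · intro ω _ hω
    have : ω = 0 := funext fun j => hω j (by simp)
    rw [this, h0]
  · rintro ω ⟨j, _, hj⟩
    exact h1 ω ⟨j, hj⟩
  · simp

end VonNeumann

/-! ### Dual functions -/

section Dual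

variable {V : Type*} [Fintype V] {s : ℕ}

/-- The point with coordinates `x i` where `ω i = 0` and `y i` where `ω i = 1`. -/
def boxMix {V : Type*} {s : ℕ} (ω : Fin s → Fin 2) (x y : Fin s → V) : Fin s → V :=
  fun i => if ω i = 0 then x i else y i

/-- The dual function of a family, for the vertex `0` of the cube. -/
noncomputable def boxDual {V : Type*} [Fintype V] {s : ℕ}
    (a : (Fin s → Fin 2) → (Fin s → V) → ℝ) (x : Fin s → V) : ℝ :=
  𝔼 y : Fin s → V, ∏ ω with ω ≠ 0, a ω (boxMix ω x y)

theorem boxDual_congr {a b : (Fin s → Fin 2) → (Fin s → V) → ℝ} (h : ∀ ω, ω ≠ 0 → a ω = b ω) :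
    boxDual a = boxDual b := by
  funext x
  refine Finset.expect_congr rfl fun y _ => Finset.prod_congr rfl fun ω hω => ?_
  rw [h ω (by simpa using hω)]

theorem abs_boxDual_le {a w : (Fin s → Fin 2) → (Fin s → V) → ℝ}
    (h : ∀ ω, ω ≠ 0 → ∀ v, |a ω v| ≤ w ω v) (x : Fin s → V) : |boxDual a x| ≤ boxDual w x := by
  refine (Finset.abs_expect_le _ _).trans (Finset.expect_le_expect fun v _ => ?_)
  rw [Finset.abs_prod]
  exact Finset.prod_le_prod (fun _ _ => abs_nonneg _) fun ω hω => h ω (by simpa using hω) _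

theorem boxDual_one [Nonempty V] : boxDual (1 : (Fin s → Fin 2) → (Fin s → V) → ℝ) = 1 := by
  funext x
  simp [boxDual]

/-- Vertex `0` reads only column 0, so its factor comes out of the average over column 1. -/
theorem boxForm_two_eq (h : (Fin s → Fin 2) → (Fin s → V) → ℝ) :
    boxForm 2 h = 𝔼 x, h 0 x * boxDual h x := by
  let e : (Fin s → Fin 2 → V) ≃ (Fin s → V) × (Fin s → V) :=
    { toFun := fun X => (fun i => X i 0, fun i => X i 1)
      invFun := fun p i => ![p.1 i, p.2 i]
      left_inv := fun X => by funext i k; fin_cases k <;> rfl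
      right_inv := fun p => rfl }
  simp only [boxDual, Finset.mul_expect]
  rw [← expect_prod_type]
  refine Fintype.expect_equiv e _ _ fun X => ?_
  rw [← Finset.mul_prod_erase _ _ (Finset.mem_univ (0 : Fin s → Fin 2))]
  congr 1
  refine Finset.prod_congr (by ext; simp) fun ω _ => ?_
  congr 1
  funext i
  simp only [boxProj, boxMix, e]
  generalize ω i = k
  fin_cases k <;> rfl

/-- Adding `τ` swaps the two columns in the rows where `τ i = 1`. Any vertex can thus be moved to
`0`. -/
theorem boxForm_two_shift (h : (Fin s → Fin 2) → (Fin s → V) → ℝ) (τ : Fin s → Fin 2) :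
    boxForm 2 (fun ω => h (ω + τ)) = boxForm 2 h := by
  let e : (Fin s → Fin 2 → V) ≃ (Fin s → Fin 2 → V) :=
    Equiv.piCongrRight fun i => (Equiv.addRight (τ i)).arrowCongr (Equiv.refl V)
  refine Fintype.expect_equiv e _ _ fun X => ?_
  refine Fintype.prod_equiv (Equiv.addRight τ) _ _ fun ω => ?_
  congr 1
  funext i
  simp [boxProj, e, Equiv.arrowCongr]

/-- The family on `[4]^s` encoding the average of `g * boxDual a * boxDual b`. -/
def dualPairFamily {V : Type*} {s : ℕ} (g : (Fin s → V) → ℝ)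
    (a b : (Fin s → Fin 2) → (Fin s → V) → ℝ) (ω : Fin s → Fin 4) : (Fin s → V) → ℝ :=
  if ω = 0 then g
  else if ∀ i, ω i = 0 ∨ ω i = 2 then a fun i => if ω i = 0 then 0 else 1
  else if ∀ i, ω i = 0 ∨ ω i = 3 then b fun i => if ω i = 0 then 0 else 1
  else 1

/-- The vertex of `[4]^s` with value `c` where `ω` is nonzero. -/
def liftVertex {s : ℕ} (c : Fin 4) (ω : Fin s → Fin 2) : Fin s → Fin 4 :=
  fun i => if ω i = 0 then 0 else c

theorem liftVertex_reduce {c : Fin 4} (hc : c ≠ 0) (ω : Fin s → Fin 2) :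
    (fun i => if liftVertex c ω i = 0 then (0 : Fin 2) else 1) = ω := by
  funext i
  unfold liftVertex
  generalize ω i = k
  fin_cases k <;> simp [hc]

theorem liftVertex_ne_zero {c : Fin 4} (hc : c ≠ 0) {ω : Fin s → Fin 2} (hω : ω ≠ 0) :
    liftVertex c ω ≠ 0 := by
  intro h
  apply hω
  rw [← liftVertex_reduce hc ω, h]
  rfl

theorem dualPairFamily_lift_two {V : Type*} (g : (Fin s → V) → ℝ) (a b : (Fin s → Fin 2) → (Fin s → V) → ℝ)
    {ω : Fin s → Fin 2} (hω : ω ≠ 0) : dualPairFamily g a b (liftVertex 2 ω) = a ω := by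
  rw [dualPairFamily, if_neg (liftVertex_ne_zero (by decide) hω), if_pos,
    liftVertex_reduce (by decide)]
  intro i
  unfold liftVertex
  split_ifs <;> simp

theorem dualPairFamily_lift_three {V : Type*} (g : (Fin s → V) → ℝ)
    (a b : (Fin s → Fin 2) → (Fin s → V) → ℝ)
    {ω : Fin s → Fin 2} (hω : ω ≠ 0) : dualPairFamily g a b (liftVertex 3 ω) = b ω := by
  obtain ⟨j, hj⟩ := Function.ne_iff.1 hω
  rw [dualPairFamily, if_neg (liftVertex_ne_zero (by decide) hω), if_neg, if_pos,
    liftVertex_reduce (by decide)]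
  · intro i
    unfold liftVertex
    split_ifs <;> simp
  · intro h
    have := h j
    simp only [liftVertex] at this
    rw [if_neg (by simpa using hj)] at this
    revert this; decide

/-- The base point and the two independent dual variables become columns 0, 2 and 3. Column 1
carries no factor: it is the slot that the von Neumann argument doubles into. -/
theorem expect_mul_boxDual_mul_boxDual [Nonempty V] (g : (Fin s → V) → ℝ)
    (a b : (Fin s → Fin 2) → (Fin s → V) → ℝ) :
    𝔼 x, g x * boxDual a x * boxDual b x = boxForm 4 (dualPairFamily g a b) := by
  let e : (Fin s → Fin 4 → V) ≃
      ((Fin s → V) × (Fin s → V)) × ((Fin s → V) × (Fin s → V)) :=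
    { toFun := fun X => ((fun i => X i 0, fun i => X i 1), (fun i => X i 2, fun i => X i 3))
      invFun := fun p i => ![p.1.1 i, p.1.2 i, p.2.1 i, p.2.2 i]
      left_inv := fun X => by funext i k; fin_cases k <;> rfl
      right_inv := fun p => rfl }
  let G : (Fin s → V) → (Fin s → V) → (Fin s → V) → ℝ := fun x y y' =>
    g x * (∏ ω with ω ≠ 0, a ω (boxMix ω x y)) * ∏ ω with ω ≠ 0, b ω (boxMix ω x y')
  have h1 : 𝔼 x, g x * boxDual a x * boxDual b x = 𝔼 x, 𝔼 y, 𝔼 y', G x y y' := by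
    refine Finset.expect_congr rfl fun x _ => ?_
    simp only [boxDual, G, Finset.mul_expect, Finset.expect_mul]
    rw [Finset.expect_comm]
  have h2 : boxForm 4 (dualPairFamily g a b)
      = 𝔼 p : ((Fin s → V) × (Fin s → V)) × ((Fin s → V) × (Fin s → V)),
        G p.1.1 p.2.1 p.2.2 := by
    refine Fintype.expect_equiv e _ _ fun X => ?_
    -- The possibly nontrivial factors sit at `0` and at the lifts by 2 and by 3 of nonzero
    -- vertices; these indices are distinct.
    have := Fintype.prod_of_injective
      (fun o : Option ({ω : Fin s → Fin 2 // ω ≠ 0} ⊕ {ω : Fin s → Fin 2 // ω ≠ 0}) =>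
        o.elim (0 : Fin s → Fin 4)
          (Sum.elim (fun ω => liftVertex 2 ω.1) (fun ω => liftVertex 3 ω.1)))
      (by
        have hne : ∀ ω ω' : {ω : Fin s → Fin 2 // ω ≠ 0},
            liftVertex 2 ω.1 ≠ liftVertex 3 ω'.1 := by
          intro ω ω' h
          obtain ⟨j, hj⟩ := Function.ne_iff.1 ω.2
          have h' := congrFun h j
          simp only [liftVertex] at h'
          rw [if_neg (by simpa using hj)] at h'
          split_ifs at h' <;> revert h' <;> decide
        have hinj : ∀ c : Fin 4, c ≠ 0 → ∀ ω ω' : {ω : Fin s → Fin 2 // ω ≠ 0},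
            liftVertex c ω.1 = liftVertex c ω'.1 → ω = ω' := by
          intro c hc ω ω' h
          apply Subtype.ext
          rw [← liftVertex_reduce hc ω.1, h, liftVertex_reduce hc]
        have h20 := fun ω : {ω : Fin s → Fin 2 // ω ≠ 0} =>
          liftVertex_ne_zero (c := 2) (by decide) ω.2
        have h30 := fun ω : {ω : Fin s → Fin 2 // ω ≠ 0} =>
          liftVertex_ne_zero (c := 3) (by decide) ω.2
        rintro (_ | ω | ω) (_ | ω' | ω') h
        · rfl
        · exact (h20 ω' h.symm).elim
        · exact (h30 ω' h.symm).elim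
        · exact (h20 ω h).elim
        · rw [hinj 2 (by decide) _ _ h]
        · exact (hne _ _ h).elim
        · exact (h30 ω h).elim
        · exact (hne _ _ h.symm).elim
        · rw [hinj 3 (by decide) _ _ h])
      (fun o => dualPairFamily g a b _ (boxProj _ X))
      (fun ω => dualPairFamily g a b ω (boxProj ω X))
      (by
        intro ω hω
        rw [dualPairFamily, if_neg, if_neg, if_neg]
        · rfl
        · intro h
          by_cases h0 : ω = 0
          · exact hω ⟨none, h0.symm⟩
          refine hω ⟨some (Sum.inr ⟨fun i => if ω i = 0 then 0 else 1, fun h' => h0 ?_⟩), ?_⟩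
          · funext i
            by_contra hi
            simpa [show ω i ≠ 0 from hi] using congrFun h' i
          · funext i
            rcases h i with hi | hi <;> simp [liftVertex, hi]
        · intro h
          by_cases h0 : ω = 0
          · exact hω ⟨none, h0.symm⟩
          refine hω ⟨some (Sum.inl ⟨fun i => if ω i = 0 then 0 else 1, fun h' => h0 ?_⟩), ?_⟩
          · funext i
            by_contra hi
            simpa [show ω i ≠ 0 from hi] using congrFun h' i
          · funext i
            rcases h i with hi | hi <;> simp [liftVertex, hi]
        · intro h
          exact hω ⟨none, h.symm⟩)
      (fun _ => rfl)
    rw [← this, Fintype.prod_option, Fintype.prod_sum_type, ← mul_assoc]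
    simp only [Option.elim, Sum.elim_inl, Sum.elim_inr, G]
    have hproj : ∀ (c : Fin 4) (ω : Fin s → Fin 2), boxProj (liftVertex c ω) X
        = boxMix ω (fun i => X i 0) (fun i => X i c) := by
      intro c ω
      funext i
      simp only [boxProj, liftVertex, boxMix]
      split_ifs <;> rfl
    congr 1
    · congr 1
      · rw [dualPairFamily, if_pos rfl]; rfl
      · rw [Finset.prod_subtype (p := fun ω : Fin s → Fin 2 => ω ≠ 0) _ (by simp)]
        refine Finset.prod_congr rfl fun ω _ => ?_
        rw [dualPairFamily_lift_two g a b ω.2, hproj]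
        rfl
    · rw [Finset.prod_subtype (p := fun ω : Fin s → Fin 2 => ω ≠ 0) _ (by simp)]
      refine Finset.prod_congr rfl fun ω _ => ?_
      rw [dualPairFamily_lift_three g a b ω.2, hproj]
      rfl
  rw [h1, h2, expect_prod_type (fun (q q' : (Fin s → V) × (Fin s → V)) => G q.1 q'.1 q'.2),
    expect_prod_type (fun (x _ : Fin s → V) => 𝔼 q' : (Fin s → V) × (Fin s → V), G x q'.1 q'.2)]
  refine Finset.expect_congr rfl fun x _ => ?_
  rw [Fintype.expect_const, expect_prod_type (G x)]

end Dual

/-! ### Cut functions and the cut norm -/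

section Cut

/-- Products of `1`-bounded functions `u i`, where `u i` does not depend on the `i`-th
coordinate. -/
def cutFunctions (V : Type*) (s : ℕ) : Submonoid ((Fin s → V) → ℝ) where
  carrier := {φ | ∃ u : Fin s → (Fin s → V) → ℝ, (∀ i v, |u i v| ≤ 1) ∧
    (∀ i v z, u i (Function.update v i z) = u i v) ∧ φ = fun v => ∏ i, u i v}
  mul_mem' := by
    rintro _ _ ⟨u, hu, hu', rfl⟩ ⟨w, hw, hw', rfl⟩
    refine ⟨fun i v => u i v * w i v, fun i v => ?_, fun i v z => ?_, ?_⟩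
    · simp only [abs_mul]
      exact mul_le_one₀ (hu i v) (abs_nonneg _) (hw i v)
    · simp only [hu', hw']
    · funext v
      simp [Finset.prod_mul_distrib]
  one_mem' := ⟨fun _ _ => 1, by simp, by simp, by funext v; simp⟩

variable {V : Type*} {s : ℕ}

theorem abs_le_one_of_mem_cutFunctions {φ : (Fin s → V) → ℝ} (hφ : φ ∈ cutFunctions V s)
    (v : Fin s → V) : |φ v| ≤ 1 := by
  obtain ⟨u, hu, -, rfl⟩ := hφ
  simp only [Finset.abs_prod]
  exact Finset.prod_le_one (fun _ _ => abs_nonneg _) fun i _ => hu i v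

theorem mem_cutFunctions_of_indep {φ : (Fin s → V) → ℝ} (i : Fin s) (hφ : ∀ v, |φ v| ≤ 1)
    (hi : ∀ v z, φ (Function.update v i z) = φ v) : φ ∈ cutFunctions V s := by
  refine ⟨fun j => if j = i then φ else 1, fun j v => ?_, fun j v z => ?_, ?_⟩
  · dsimp only
    split_ifs
    · exact hφ v
    · simp
  · dsimp only
    split_ifs with h
    · subst h; exact hi v z
    · rfl
  · funext v
    rw [Finset.prod_eq_single i] <;> simp +contextual

theorem neg_mem_cutFunctions (hs : 0 < s) {φ : (Fin s → V) → ℝ} (hφ : φ ∈ cutFunctions V s) :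
    -φ ∈ cutFunctions V s := by
  have h1 : (fun _ => -1 : (Fin s → V) → ℝ) ∈ cutFunctions V s :=
    mem_cutFunctions_of_indep ⟨0, hs⟩ (by simp) (by simp)
  convert mul_mem h1 hφ using 1
  funext v
  simp

variable [Fintype V] [Nonempty V] {ν : (Fin s → V) → ℝ} {η : ℝ}

/-- The measure `ν` is close to `1` in cut norm. -/
theorem abs_expect_sub_one_mul_cutFunction_le (hs : 0 < s) (hη : 0 < η) (hη1 : η ≤ 1)
    (hCη : linearFormsConst s * η ≤ 1) (hν : lBoxNorm 4 (fun v => ν v - 1) ≤ η)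
    {φ : (Fin s → V) → ℝ} (hφ : φ ∈ cutFunctions V s) :
    |𝔼 v, (ν v - 1) * φ v| ≤ vonNeumannErr s (linearFormsConst s * η) := by
  obtain ⟨u, hu, hu', rfl⟩ := hφ
  -- Place `u i` at the i-th unit vertex: there only coordinate `i` is replaced, which `u i`
  -- ignores, so the dual function is the given product.
  set a : (Fin s → Fin 2) → (Fin s → V) → ℝ := fun ω v =>
    ∏ i, if ω = Pi.single i 1 then u i v else 1 with ha
  have ha1 : ∀ ω v, |a ω v| ≤ 1 := fun ω v => by
    simp only [ha, Finset.abs_prod]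
    refine Finset.prod_le_one (fun _ _ => abs_nonneg _) fun i _ => ?_
    split_ifs
    · exact hu i v
    · simp
  have hD : boxDual a = fun v => ∏ i, u i v := by
    funext x
    have : ∀ y : Fin s → V, ∏ ω with ω ≠ 0, a ω (boxMix ω x y) = ∏ i, u i x := by
      intro y
      simp only [ha]
      rw [Finset.prod_comm]
      refine Finset.prod_congr rfl fun i _ => ?_
      rw [Finset.prod_eq_single_of_mem (Pi.single i 1)]
      · rw [if_pos rfl, ← hu' i x (y i)]
        congr 1
        funext j
        by_cases hj : j = i
        · subst hj; simp [boxMix]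
        · simp [boxMix, hj]
      · simp
      · intro ω _ hω
        rw [if_neg hω]
    simp [boxDual, this]
  have h := expect_mul_boxDual_mul_boxDual (fun v => ν v - 1) a 1
  simp only [hD, boxDual_one, Pi.one_apply, mul_one] at h
  rw [h]
  refine abs_boxForm_four_le_vonNeumannErr hs hη hη1 hCη hν _ (by simp [dualPairFamily]) ?_ ?_
  · rintro ω ⟨j, hj⟩
    rw [dualPairFamily, if_neg, if_neg, if_neg]
    · intro h; have := h j; rw [hj] at this; revert this; decide
    · intro h; have := h j; rw [hj] at this; revert this; decide
    · rintro rfl; revert hj; simp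
  · rintro ω ⟨j, hj, -⟩
    left
    intro v
    rw [dualPairFamily, if_neg (by rintro rfl; exact hj rfl)]
    split_ifs
    · exact ha1 _ v
    · simp
    · simp

/-- A vertex `ω ≠ 0` reads some coordinate from `y`, so its factor ignores that coordinate of `x`.
-/
theorem prod_boxMix_mem_cutFunctions {V : Type*} {h : (Fin s → Fin 2) → (Fin s → V) → ℝ}
    (hh : ∀ ω, ω ≠ 0 → ∀ v, |h ω v| ≤ 1) (y : Fin s → V) :
    (fun x => ∏ ω with ω ≠ 0, h ω (boxMix ω x y)) ∈ cutFunctions V s := by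
  have e : (fun x => ∏ ω with ω ≠ 0, h ω (boxMix ω x y))
      = ∏ ω with ω ≠ 0, fun x => h ω (boxMix ω x y) := by
    funext x; simp
  rw [e]
  refine prod_mem fun ω hω => ?_
  have hω : ω ≠ 0 := by simpa using hω
  obtain ⟨i, hi⟩ := Function.ne_iff.1 hω
  refine mem_cutFunctions_of_indep i (fun v => hh ω hω _) fun v z => ?_
  congr 1
  funext j
  by_cases hj : j = i
  · subst hj; simp only [boxMix]; rw [if_neg (by simpa using hi), if_neg (by simpa using hi)]
  · simp [boxMix, hj]

theorem abs_boxForm_two_le_of_cut {h : (Fin s → Fin 2) → (Fin s → V) → ℝ} {ε : ℝ}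
    (hh : ∀ ω, ω ≠ 0 → ∀ v, |h ω v| ≤ 1)
    (hε : ∀ φ ∈ cutFunctions V s, |𝔼 v, h 0 v * φ v| ≤ ε) : |boxForm 2 h| ≤ ε := by
  rw [boxForm_two_eq]
  simp only [boxDual, Finset.mul_expect]
  rw [Finset.expect_comm]
  refine (Finset.abs_expect_le _ _).trans (Finset.expect_le Finset.univ_nonempty fun y _ => ?_)
  exact hε _ (prod_boxMix_mem_cutFunctions hh y)

/-! ### Densification and relative counting -/

/-- The error in one densification step. -/
noncomputable def densifyErr (s : ℕ) (t : ℝ) : ℝ := vonNeumannErr s t + √(3 * t) + 3 * t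

/-- The error after `k` densification steps. -/
noncomputable def countErr (ε r : ℝ) : ℕ → ℝ
  | 0 => ε
  | k + 1 => √(2 * (countErr ε r k + r))

/-- Truncation to `[-1, 1]`. -/
noncomputable def truncate (t : ℝ) : ℝ := max (-1) (min t 1)

theorem abs_truncate_le (t : ℝ) : |truncate t| ≤ 1 := by
  rw [abs_le, truncate]
  exact ⟨le_max_left _ _, max_le (by norm_num) (min_le_right _ _)⟩

/-- Only the excess of `|t|` over 1 is cut off. The truncation error of a dual function is thus
controlled by that of its majorant from 1. -/
theorem abs_sub_truncate_le {t m : ℝ} (h : |t| ≤ m) : |t - truncate t| ≤ |m - 1| := by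
  obtain ⟨h1, h2⟩ := abs_le.1 h
  rw [truncate]
  rcases le_total t 1 with h3 | h3
  · rw [min_eq_left h3]
    rcases le_total (-1) t with h4 | h4
    · simp [max_eq_right h4]
    · rw [max_eq_left h4, abs_of_nonpos (by linarith), abs_of_nonneg (by linarith)]
      linarith
  · rw [min_eq_right h3, max_eq_right (by norm_num), abs_of_nonneg (by linarith),
      abs_of_nonneg (by linarith)]
    linarith

theorem abs_expect_dualPairFamily_sub_one_le (hs : 0 < s) (hη : 0 < η) (hη1 : η ≤ 1)
    (hν : lBoxNorm 4 (fun v => ν v - 1) ≤ η) {g : (Fin s → V) → ℝ}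
    {a b : (Fin s → Fin 2) → (Fin s → V) → ℝ} (hg : g = 1 ∨ g = ν)
    (ha : ∀ ω, a ω = 1 ∨ a ω = ν) (hb : ∀ ω, b ω = 1 ∨ b ω = ν) :
    |𝔼 x, g x * boxDual a x * boxDual b x - 1| ≤ linearFormsConst s * η := by
  rw [expect_mul_boxDual_mul_boxDual]
  refine abs_boxForm_four_sub_one_le_of_eq hs hη hη1 hν _ fun ω => ?_
  unfold dualPairFamily
  split_ifs
  · exact hg
  · exact ha _
  · exact hb _
  · exact Or.inl rfl

theorem expect_measure_le_two (hs : 0 < s) (hη : 0 < η) (hη1 : η ≤ 1)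
    (hCη : linearFormsConst s * η ≤ 1) (hν : lBoxNorm 4 (fun v => ν v - 1) ≤ η) :
    𝔼 v, ν v ≤ 2 := by
  have h := abs_expect_dualPairFamily_sub_one_le (g := ν) (a := 1) (b := 1) hs hη hη1 hν
    (Or.inr rfl) (fun _ => Or.inl rfl) (fun _ => Or.inl rfl)
  simp only [boxDual_one, Pi.one_apply, mul_one] at h
  linarith [(abs_le.1 h).2]

/-- Weighted second moment of a dual function: the weight `ν` can be dropped and the dual
function truncated. -/
theorem expect_measure_mul_boxDual_sq_le (hs : 0 < s) (hη : 0 < η) (hη1 : η ≤ 1)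
    (hCη : linearFormsConst s * η ≤ 1) (hν : lBoxNorm 4 (fun v => ν v - 1) ≤ η)
    (h : (Fin s → Fin 2) → (Fin s → V) → ℝ)
    (hh : ∀ ω, (∀ v, |h ω v| ≤ 1) ∨ ∀ v, |h ω v| ≤ ν v) :
    𝔼 x, ν x * boxDual h x ^ 2 ≤
      𝔼 x, truncate (boxDual h x) * boxDual h x + densifyErr s (linearFormsConst s * η) := by
  classical
  set t := linearFormsConst s * η with ht
  have ht0 : 0 ≤ t := mul_nonneg (linearFormsConst_pos s).le hη.le
  set w : (Fin s → Fin 2) → (Fin s → V) → ℝ := fun ω => if ∀ v, |h ω v| ≤ 1 then 1 else ν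
    with hw
  have hw1 : ∀ ω, w ω = 1 ∨ w ω = ν := fun ω => by simp only [hw]; split_ifs <;> simp
  have hhw : ∀ ω, ω ≠ 0 → ∀ v, |h ω v| ≤ w ω v := by
    intro ω _ v
    simp only [hw]
    split_ifs with h1
    · exact h1 v
    · exact (hh ω).resolve_left h1 v
  have hle : ∀ x, |boxDual h x| ≤ boxDual w x := abs_boxDual_le hhw
  have hw0 : ∀ x, 0 ≤ boxDual w x := fun x => (abs_nonneg _).trans (hle x)
  have m1 : |𝔼 x, (ν x - 1) * boxDual h x ^ 2| ≤ vonNeumannErr s t := by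
    have e := expect_mul_boxDual_mul_boxDual (fun v => ν v - 1) h h
    simp only [mul_assoc, ← sq] at e
    rw [e]
    refine abs_boxForm_four_le_vonNeumannErr hs hη hη1 hCη hν _ (by simp [dualPairFamily]) ?_ ?_
    · rintro ω ⟨j, hj⟩
      rw [dualPairFamily, if_neg, if_neg, if_neg]
      · intro h; have := h j; rw [hj] at this; revert this; decide
      · intro h; have := h j; rw [hj] at this; revert this; decide
      · rintro rfl; revert hj; simp
    · rintro ω ⟨j, hj, -⟩
      rw [dualPairFamily, if_neg (by rintro rfl; exact hj rfl)]
      split_ifs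
      · exact hh _
      · exact hh _
      · left; simp
  have m2 := abs_expect_dualPairFamily_sub_one_le (g := 1) (a := w) (b := w) hs hη hη1 hν
    (Or.inl rfl) hw1 hw1
  have m3 := abs_expect_dualPairFamily_sub_one_le (g := 1) (a := w) (b := 1) hs hη hη1 hν
    (Or.inl rfl) hw1 (fun _ => Or.inl rfl)
  simp only [boxDual_one, Pi.one_apply, one_mul, mul_one] at m2 m3
  -- Both moments are within `t` of 1: `(1 + t) - 2 * (1 - t) + 1 = 3 * t`.
  have m4 : 𝔼 x, (boxDual w x - 1) ^ 2 ≤ 3 * t := by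
    have : 𝔼 x, (boxDual w x - 1) ^ 2
        = 𝔼 x, boxDual w x * boxDual w x - 2 * 𝔼 x, boxDual w x + 1 := by
      rw [Finset.mul_expect, ← Finset.expect_sub_distrib,
        ← Fintype.expect_const (ι := Fin s → V) (1 : ℝ), ← Finset.expect_add_distrib]
      refine Finset.expect_congr rfl fun x _ => ?_
      rw [Fintype.expect_const]
      ring
    rw [this]
    linarith [(abs_le.1 m2).2, (abs_le.1 m3).1]
  have m5 : 𝔼 x, |boxDual w x - 1| ≤ √(3 * t) := by
    refine Real.le_sqrt_of_sq_le (le_trans ?_ m4)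
    have := Finset.expect_mul_sq_le_sq_mul_sq Finset.univ
      (fun x : Fin s → V => |boxDual w x - 1|) 1
    simpa using this
  have m6 : 𝔼 x, boxDual h x * (boxDual h x - truncate (boxDual h x)) ≤ √(3 * t) + 3 * t := by
    calc 𝔼 x, boxDual h x * (boxDual h x - truncate (boxDual h x))
        ≤ 𝔼 x, (|boxDual w x - 1| + (boxDual w x - 1) ^ 2) := by
          refine Finset.expect_le_expect fun x _ => ?_
          calc boxDual h x * (boxDual h x - truncate (boxDual h x))
              ≤ |boxDual h x| * |boxDual h x - truncate (boxDual h x)| := by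
                rw [← abs_mul]; exact le_abs_self _
            _ ≤ boxDual w x * |boxDual w x - 1| :=
                mul_le_mul (hle x) (abs_sub_truncate_le (hle x)) (abs_nonneg _) (hw0 x)
            _ ≤ _ := by
                rw [← sq_abs (boxDual w x - 1)]
                nlinarith [abs_nonneg (boxDual w x - 1), le_abs_self (boxDual w x - 1)]
      _ ≤ _ := by
          rw [Finset.expect_add_distrib]
          exact add_le_add m5 m4
  have split : 𝔼 x, ν x * boxDual h x ^ 2 = 𝔼 x, (ν x - 1) * boxDual h x ^ 2 +
      (𝔼 x, truncate (boxDual h x) * boxDual h x +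
        𝔼 x, boxDual h x * (boxDual h x - truncate (boxDual h x))) := by
    rw [← Finset.expect_add_distrib, ← Finset.expect_add_distrib]
    refine Finset.expect_congr rfl fun x _ => ?_
    ring
  rw [split, densifyErr]
  linarith [(abs_le.1 m1).2]

/-- The relative counting lemma for the box norm, by densification. -/
theorem abs_boxForm_two_le_countErr (hs : 0 < s) (hη : 0 < η) (hη1 : η ≤ 1)
    (hCη : linearFormsConst s * η ≤ 1) (hν : lBoxNorm 4 (fun v => ν v - 1) ≤ η)
    {f : (Fin s → V) → ℝ} (hf : ∀ v, |f v| ≤ ν v) {ε : ℝ}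
    (hε : ∀ φ ∈ cutFunctions V s, |𝔼 v, f v * φ v| ≤ ε) (k : ℕ) :
    ∀ (A : Finset (Fin s → Fin 2)) (h : (Fin s → Fin 2) → (Fin s → V) → ℝ), A.card = k + 1 →
      (∀ ω ∈ A, h ω = f) → (∀ ω ∉ A, ∀ v, |h ω v| ≤ 1) →
      |boxForm 2 h| ≤ countErr ε (densifyErr s (linearFormsConst s * η)) k := by
  have shift : ∀ c : ℝ, ∀ k : ℕ,
      (∀ (A : Finset (Fin s → Fin 2)) (h : (Fin s → Fin 2) → (Fin s → V) → ℝ), 0 ∈ A →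
        A.card = k + 1 → (∀ ω ∈ A, h ω = f) → (∀ ω ∉ A, ∀ v, |h ω v| ≤ 1) →
        |boxForm 2 h| ≤ c) →
      ∀ (A : Finset (Fin s → Fin 2)) (h : (Fin s → Fin 2) → (Fin s → V) → ℝ), A.card = k + 1 →
        (∀ ω ∈ A, h ω = f) → (∀ ω ∉ A, ∀ v, |h ω v| ≤ 1) → |boxForm 2 h| ≤ c := by
    intro c k H A h hA hA1 hA2
    obtain ⟨τ, hτ⟩ : A.Nonempty := by rw [← Finset.card_pos]; omega
    rw [← boxForm_two_shift h τ]
    refine H (A.map (Equiv.subRight τ).toEmbedding) _ ?_ (by simpa using hA) ?_ ?_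
    · exact Finset.mem_map.2 ⟨τ, hτ, by simp⟩
    · intro ω hω
      obtain ⟨ω', hω', rfl⟩ := Finset.mem_map.1 hω
      simpa using hA1 ω' hω'
    · intro ω hω
      refine hA2 _ fun hω' => hω (Finset.mem_map.2 ⟨_, hω', by simp⟩)
  induction k with
  | zero =>
    refine shift _ 0 fun A h h0 hA hA1 hA2 => ?_
    obtain ⟨a, rfl⟩ := Finset.card_eq_one.1 hA
    obtain rfl : (0 : Fin s → Fin 2) = a := by simpa using h0
    refine abs_boxForm_two_le_of_cut (fun ω hω => hA2 ω (by simpa using hω)) fun φ hφ => ?_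
    rw [hA1 0 h0]
    exact hε φ hφ
  | succ k ih =>
    refine shift _ (k + 1) fun A h h0 hA hA1 hA2 => ?_
    have hν0 : ∀ v, 0 ≤ ν v := fun v => (abs_nonneg _).trans (hf v)
    -- Putting the truncated dual function at vertex `0` gives a form with one copy of `f` fewer.
    have hd : 𝔼 x, truncate (boxDual h x) * boxDual h x
        ≤ countErr ε (densifyErr s (linearFormsConst s * η)) k := by
      have e := boxForm_two_eq (Function.update h 0 fun x => truncate (boxDual h x))
      rw [boxDual_congr (a := Function.update h 0 fun x => truncate (boxDual h x)) (b := h)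
        (fun ω hω => Function.update_of_ne hω _ _)] at e
      simp only [Function.update_self] at e
      rw [← e]
      refine (le_abs_self _).trans (ih (A.erase 0) _ (by rw [Finset.card_erase_of_mem h0]; omega)
        (fun ω hω => ?_) fun ω hω => ?_)
      · rw [Function.update_of_ne (Finset.ne_of_mem_erase hω)]
        exact hA1 ω (Finset.mem_of_mem_erase hω)
      · by_cases hω0 : ω = 0
        · subst hω0
          simp only [Function.update_self]
          exact fun v => abs_truncate_le _
        · rw [Function.update_of_ne hω0]
          exact hA2 ω fun h' => hω (Finset.mem_erase.2 ⟨hω0, h'⟩)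
    have hsq := expect_measure_mul_boxDual_sq_le hs hη hη1 hCη hν h fun ω => by
      by_cases hω : ω ∈ A
      · right; rw [hA1 ω hω]; exact hf
      · left; exact hA2 ω hω
    have hE := expect_measure_le_two hs hη hη1 hCη hν
    have hE0 : 0 ≤ 𝔼 x, ν x * boxDual h x ^ 2 :=
      Finset.expect_nonneg fun x _ => mul_nonneg (hν0 x) (sq_nonneg _)
    have step : |𝔼 x, f x * boxDual h x| ≤ 𝔼 x, √(ν x) * (√(ν x) * |boxDual h x|) := by
      refine (Finset.abs_expect_le _ _).trans (Finset.expect_le_expect fun x _ => ?_)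
      rw [← mul_assoc, Real.mul_self_sqrt (hν0 x), abs_mul]
      exact mul_le_mul_of_nonneg_right (hf x) (abs_nonneg _)
    rw [boxForm_two_eq, hA1 0 h0]
    refine Real.le_sqrt_of_sq_le ?_
    refine (pow_le_pow_left₀ (abs_nonneg _) step 2).trans
      ((Finset.expect_mul_sq_le_sq_mul_sq _ _ _).trans ?_)
    simp only [mul_pow, Real.sq_sqrt (hν0 _), sq_abs]
    exact mul_le_mul hE (by linarith) hE0 (by norm_num)

end Cut

/-! ### The dense model theorem -/

section DenseModel

variable {X : Type*} [Fintype X]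

/-- Averaging against `g`, as a linear functional. -/
noncomputable def avgMul {X : Type*} [Fintype X] (g : X → ℝ) : (X → ℝ) →ₗ[ℝ] ℝ where
  toFun h := 𝔼 x, g x * h x
  map_add' a b := by simp only [Pi.add_apply, mul_add, Finset.expect_add_distrib]
  map_smul' c a := by
    simp only [Pi.smul_apply, smul_eq_mul, RingHom.id_apply, Finset.mul_expect]
    exact Finset.expect_congr rfl fun x _ => by ring

theorem avgMul_apply (g h : X → ℝ) : avgMul g h = 𝔼 x, g x * h x := rfl

/-- The product is bilinear, so the hull of a monoid is closed under products. Hence `ν - 1` can be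
tested against polynomials in `ψ`. -/
theorem pow_mem_convexHull {X : Type*} (Φ : Submonoid (X → ℝ)) {ψ : X → ℝ}
    (hψ : ψ ∈ convexHull ℝ (Φ : Set (X → ℝ))) (k : ℕ) :
    ψ ^ k ∈ convexHull ℝ (Φ : Set (X → ℝ)) := by
  have h1 : ∀ φ ∈ Φ, ∀ a ∈ convexHull ℝ (Φ : Set (X → ℝ)),
      a * φ ∈ convexHull ℝ (Φ : Set (X → ℝ)) := by
    intro φ hφ a ha
    refine convexHull_min (s := (Φ : Set (X → ℝ)))
      (t := LinearMap.mulRight ℝ φ ⁻¹' convexHull ℝ (Φ : Set (X → ℝ))) ?_ ?_ ha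
    · intro b hb
      exact subset_convexHull ℝ _ (Φ.mul_mem hb hφ)
    · exact (convex_convexHull ℝ _).linear_preimage _
  have h2 : ∀ a ∈ convexHull ℝ (Φ : Set (X → ℝ)), ∀ b ∈ convexHull ℝ (Φ : Set (X → ℝ)),
      a * b ∈ convexHull ℝ (Φ : Set (X → ℝ)) := by
    intro a ha b hb
    refine convexHull_min (s := (Φ : Set (X → ℝ)))
      (t := LinearMap.mulLeft ℝ a ⁻¹' convexHull ℝ (Φ : Set (X → ℝ))) ?_ ?_ hb
    · intro φ hφ
      exact h1 φ hφ a ha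
    · exact (convex_convexHull ℝ _).linear_preimage _
  induction k with
  | zero => exact subset_convexHull ℝ _ (by simp)
  | succ k ih => rw [pow_succ]; exact h2 _ ih _ hψ

theorem abs_avgMul_le_of_mem_convexHull {Φ : Set (X → ℝ)} {g : X → ℝ} {c : ℝ}
    (h : ∀ φ ∈ Φ, |avgMul g φ| ≤ c) {ψ : X → ℝ} (hψ : ψ ∈ convexHull ℝ Φ) :
    |avgMul g ψ| ≤ c := by
  have := convexHull_min (s := Φ) (t := avgMul g ⁻¹' Set.Icc (-c) c)
    (fun φ hφ => abs_le.1 (h φ hφ)) ((convex_Icc _ _).linear_preimage _) hψ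
  exact abs_le.2 this

theorem abs_le_one_of_mem_convexHull {X : Type*} {Φ : Set (X → ℝ)}
    (h : ∀ φ ∈ Φ, ∀ x, |φ x| ≤ 1) {ψ : X → ℝ} (hψ : ψ ∈ convexHull ℝ Φ) (x : X) :
    |ψ x| ≤ 1 := by
  have := convexHull_min (s := Φ)
    (t := (LinearMap.proj x : (X → ℝ) →ₗ[ℝ] ℝ) ⁻¹' Set.Icc (-1) 1)
    (fun φ hφ => abs_le.1 (h φ hφ x)) ((convex_Icc _ _).linear_preimage _) hψ
  exact abs_le.2 this

/-- Minimax: if no `[0, 1]`-valued `H` is close to `F`, a single test function in the convex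
hull witnesses this. -/
theorem exists_test_of_forall_exists {F : X → ℝ} {Φ : Set (X → ℝ)} {ε : ℝ}
    (h : ∀ H : X → ℝ, (∀ x, 0 ≤ H x ∧ H x ≤ 1) → ∃ φ ∈ Φ, ε < 𝔼 x, (F x - H x) * φ x) :
    ∃ ψ ∈ convexHull ℝ Φ, ∀ H : X → ℝ, (∀ x, 0 ≤ H x ∧ H x ≤ 1) →
      ε < 𝔼 x, (F x - H x) * ψ x := by
  set K : Set (X → ℝ) := Set.pi Set.univ fun _ => Set.Icc (0 : ℝ) 1 with hK
  have memK : ∀ H : X → ℝ, H ∈ K ↔ ∀ x, 0 ≤ H x ∧ H x ≤ 1 := fun H => by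
    simp only [hK, Set.mem_univ_pi, Set.mem_Icc]
  have hKc : IsCompact K := isCompact_univ_pi fun _ => isCompact_Icc
  have hKconv : Convex ℝ K := convex_pi fun _ _ => convex_Icc _ _
  have hKne : K.Nonempty := ⟨0, by simp [memK]⟩
  have hcont : Continuous fun p : (X → ℝ) × (X → ℝ) => 𝔼 x, (F x - p.1 x) * p.2 x := by
    simp only [Fintype.expect_eq_sum_div_card]
    fun_prop
  -- By compactness finitely many tests suffice, as the finite form of Sion's minimax theorem
  -- requires.
  obtain ⟨T, hT⟩ := hKc.elim_finite_subcover
    (fun φ : Φ => {H : X → ℝ | ε < 𝔼 x, (F x - H x) * φ.1 x})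
    (fun φ => isOpen_lt continuous_const (hcont.comp (Continuous.prodMk_left φ.1)))
    (fun H hH => by
      obtain ⟨φ, hφ, h'⟩ := h H ((memK H).1 hH)
      exact Set.mem_iUnion.2 ⟨⟨φ, hφ⟩, h'⟩)
  have affine_left : ∀ ψ H : X → ℝ, 𝔼 x, (F x - H x) * ψ x = avgMul F ψ - avgMul ψ H := by
    intro ψ H
    rw [avgMul_apply, avgMul_apply, ← Finset.expect_sub_distrib]
    exact Finset.expect_congr rfl fun x _ => by ring
  obtain ⟨ψ, hψ, h'⟩ := Sion.exists_lt_iInf_of_lt_iInf_of_finite (X := K)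
    (Y := convexHull ℝ Φ) (f := fun H ψ => 𝔼 x, (F x - H x) * ψ x) hKne hKc
    (fun ψ _ => (hcont.comp (Continuous.prodMk_left ψ)).continuousOn.lowerSemicontinuousOn)
    (fun ψ _ => by
      refine ConvexOn.quasiconvexOn ?_
      simp only [affine_left]
      exact (convexOn_const _ hKconv).sub ((avgMul ψ).concaveOn hKconv))
    (convex_convexHull ℝ _)
    (fun H _ => (hcont.comp (Continuous.prodMk_right H)).continuousOn.upperSemicontinuousOn)
    (fun H _ => ((avgMul fun x => F x - H x).concaveOn (convex_convexHull ℝ _)).quasiconcaveOn)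
    hKconv (s := Subtype.val '' (T : Set Φ)) (T.finite_toSet.image _)
    (by
      rintro _ ⟨φ, _, rfl⟩
      exact subset_convexHull ℝ _ φ.2)
    (t := ε)
    (fun H hH => by
      obtain ⟨φ, hφ, h'⟩ := Set.mem_iUnion₂.1 (hT hH)
      exact ⟨φ.1, ⟨φ, hφ, rfl⟩, h'⟩)
  exact ⟨ψ, hψ, fun H hH => h' H ((memK H).2 hH)⟩

/-- The dense model theorem for nonnegative functions. -/
theorem exists_denseModel_nonneg {ε : ℝ} (hε : 0 < ε) :
    ∃ ε' > 0, ∀ (X : Type u) [Fintype X] [Nonempty X] (Φ : Submonoid (X → ℝ)) (ν F : X → ℝ),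
      (∀ φ ∈ Φ, ∀ x, |φ x| ≤ 1) → (∀ φ ∈ Φ, -φ ∈ Φ) → (∀ x, 0 ≤ F x) → (∀ x, F x ≤ ν x) →
      (∀ φ ∈ Φ, |𝔼 x, (ν x - 1) * φ x| ≤ ε') →
      ∃ H : X → ℝ, (∀ x, 0 ≤ H x ∧ H x ≤ 1) ∧ ∀ φ ∈ Φ, |𝔼 x, (F x - H x) * φ x| ≤ ε := by
  obtain ⟨p, hp⟩ := exists_polynomial_near_of_continuousOn (-1) 1 (fun t => max t 0)
    (by fun_prop) (ε / 8) (by positivity)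
  set S := ∑ k ∈ Finset.range (p.natDegree + 1), |p.coeff k| with hS
  have hS0 : 0 ≤ S := Finset.sum_nonneg fun _ _ => abs_nonneg _
  -- The bound 1 keeps the average of `ν + 1` below 3. The errors are then `ε / 4` from the
  -- polynomial and `3 * (ε / 8)` from the approximation, less than `ε` in total.
  refine ⟨min 1 (ε / (4 * (1 + S))), by positivity, ?_⟩
  intro X _ _ Φ ν F hΦ1 hneg hF0 hFν hν
  set ε' := min 1 (ε / (4 * (1 + S)))
  have hε'1 : ε' ≤ 1 := min_le_left _ _
  have hε'S : S * ε' ≤ ε / 4 := by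
    have hpos : 0 < 1 + S := by positivity
    calc S * ε' ≤ (1 + S) * (ε / (4 * (1 + S))) :=
          mul_le_mul (by linarith) (min_le_right _ _) (by positivity) hpos.le
      _ = ε / 4 := by field_simp
  suffices h : ∃ H : X → ℝ, (∀ x, 0 ≤ H x ∧ H x ≤ 1) ∧
      ∀ φ ∈ (Φ : Set (X → ℝ)), 𝔼 x, (F x - H x) * φ x ≤ ε by
    obtain ⟨H, hH, hφ⟩ := h
    refine ⟨H, hH, fun φ hφ' => abs_le.2 ⟨?_, hφ φ hφ'⟩⟩
    have := hφ _ (hneg φ hφ')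
    simp only [Pi.neg_apply, mul_neg, Finset.expect_neg_distrib] at this
    linarith
  by_contra! hcon
  obtain ⟨ψ, hψ, hψH⟩ := exists_test_of_forall_exists hcon
  have hψ1 : ∀ x, |ψ x| ≤ 1 := abs_le_one_of_mem_convexHull hΦ1 hψ
  -- This `H` maximizes the average of `H * ψ`, so it is the hardest competitor for `ψ`.
  have h1 := hψH (fun x => if 0 ≤ ψ x then 1 else 0) fun x => by split_ifs <;> simp
  have h2 : 𝔼 x, (F x - if 0 ≤ ψ x then 1 else 0) * ψ x ≤ 𝔼 x, (ν x - 1) * max (ψ x) 0 := by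
    refine Finset.expect_le_expect fun x _ => ?_
    split_ifs with hx
    · rw [max_eq_left hx]
      exact mul_le_mul_of_nonneg_right (by linarith [hFν x]) hx
    · rw [max_eq_right (by linarith)]
      simpa using mul_nonpos_of_nonneg_of_nonpos (hF0 x) (not_le.1 hx).le
  have h3 : 𝔼 x, (ν x - 1) * max (ψ x) 0
      = 𝔼 x, (ν x - 1) * p.eval (ψ x) + 𝔼 x, (ν x - 1) * (max (ψ x) 0 - p.eval (ψ x)) := by
    rw [← Finset.expect_add_distrib]
    exact Finset.expect_congr rfl fun x _ => by ring
  have h4 : 𝔼 x, (ν x - 1) * p.eval (ψ x) ≤ S * ε' := by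
    have e : 𝔼 x, (ν x - 1) * p.eval (ψ x) = ∑ k ∈ Finset.range (p.natDegree + 1),
        p.coeff k * avgMul (fun x => ν x - 1) (ψ ^ k) := by
      simp only [avgMul_apply, Finset.mul_expect]
      rw [← Finset.expect_sum_comm]
      refine Finset.expect_congr rfl fun x _ => ?_
      rw [Polynomial.eval_eq_sum_range, Finset.mul_sum]
      exact Finset.sum_congr rfl fun k _ => by simp only [Pi.pow_apply]; ring
    rw [e, hS, Finset.sum_mul]
    refine Finset.sum_le_sum fun k _ => (le_abs_self _).trans ?_
    rw [abs_mul]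
    exact mul_le_mul_of_nonneg_left
      (abs_avgMul_le_of_mem_convexHull hν (pow_mem_convexHull Φ hψ k)) (abs_nonneg _)
  have h5 : 𝔼 x, (ν x + 1) ≤ 3 := by
    have := (abs_le.1 (hν 1 Φ.one_mem)).2
    simp only [Pi.one_apply, mul_one, Finset.expect_sub_distrib, Fintype.expect_const] at this
    rw [Finset.expect_add_distrib, Fintype.expect_const]
    linarith
  have h6 : 𝔼 x, (ν x - 1) * (max (ψ x) 0 - p.eval (ψ x)) ≤ 𝔼 x, (ν x + 1) * (ε / 8) := by
    refine Finset.expect_le_expect fun x _ => (le_abs_self _).trans ?_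
    rw [abs_mul]
    have hνx : 0 ≤ ν x := (hF0 x).trans (hFν x)
    refine mul_le_mul ?_ ?_ (abs_nonneg _) (by linarith)
    · rw [abs_le]; constructor <;> linarith
    · rw [abs_sub_comm]; exact (hp _ (abs_le.1 (hψ1 x))).le
  rw [← Finset.expect_mul] at h6
  have h7 : (𝔼 x, (ν x + 1)) * (ε / 8) ≤ 3 * (ε / 8) := by gcongr
  linarith

/-- The dense model theorem. -/
theorem exists_denseModel {ε : ℝ} (hε : 0 < ε) :
    ∃ ε' > 0, ∀ (X : Type u) [Fintype X] [Nonempty X] (Φ : Submonoid (X → ℝ)) (ν F : X → ℝ),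
      (∀ φ ∈ Φ, ∀ x, |φ x| ≤ 1) → (∀ φ ∈ Φ, -φ ∈ Φ) → (∀ x, |F x| ≤ ν x) →
      (∀ φ ∈ Φ, |𝔼 x, (ν x - 1) * φ x| ≤ ε') →
      ∃ H : X → ℝ, (∀ x, H x ∈ Set.Icc (-1 : ℝ) 1) ∧
        (∀ φ ∈ Φ, |𝔼 x, (F x - H x) * φ x| ≤ ε) ∧ ((∀ x, 0 ≤ F x) → ∀ x, 0 ≤ H x) := by
  obtain ⟨ε', hε', h⟩ := exists_denseModel_nonneg (half_pos hε)
  refine ⟨ε', hε', fun X _ _ Φ ν F hΦ1 hneg hF hν => ?_⟩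
  have hν0 : ∀ x, 0 ≤ ν x := fun x => (abs_nonneg _).trans (hF x)
  obtain ⟨H, hH, hHφ⟩ := h X Φ ν (fun x => max (F x) 0) hΦ1 hneg (fun x => le_max_right _ _)
    (fun x => max_le ((le_abs_self _).trans (hF x)) (hν0 x)) hν
  -- A nonnegative `F` needs only one model; otherwise subtract the models of the two parts.
  by_cases hF0 : ∀ x, 0 ≤ F x
  · refine ⟨H, fun x => ⟨by linarith [(hH x).1], (hH x).2⟩, fun φ hφ => ?_, fun _ x => (hH x).1⟩
    have := hHφ φ hφ
    simp only [max_eq_left (hF0 _)] at this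
    linarith
  · obtain ⟨H', hH', hHφ'⟩ := h X Φ ν (fun x => max (-F x) 0) hΦ1 hneg
      (fun x => le_max_right _ _) (fun x => max_le ((neg_le_abs _).trans (hF x)) (hν0 x)) hν
    refine ⟨fun x => H x - H' x, fun x => ⟨by linarith [(hH x).1, (hH' x).2],
      by linarith [(hH x).2, (hH' x).1]⟩, fun φ hφ => ?_, fun h0 => (hF0 h0).elim⟩
    have e : 𝔼 x, (F x - (H x - H' x)) * φ x
        = 𝔼 x, (max (F x) 0 - H x) * φ x - 𝔼 x, (max (-F x) 0 - H' x) * φ x := by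
      rw [← Finset.expect_sub_distrib]
      refine Finset.expect_congr rfl fun x _ => ?_
      have : F x = max (F x) 0 - max (-F x) 0 := by
        rcases le_total 0 (F x) with h0 | h0
        · rw [max_eq_left h0, max_eq_right (by linarith), sub_zero]
        · rw [max_eq_right h0, max_eq_left (by linarith)]; ring
      linear_combination φ x * this
    rw [e]
    refine (abs_sub _ _).trans ?_
    linarith [hHφ φ hφ, hHφ' φ hφ]

end DenseModel

/-! ### From qualitative bounds to a rate function -/

section Rate

/-- A family of qualitative bounds yields a rate function. -/
theorem exists_rate {P : ℝ → ℝ → Prop} (mono : ∀ η d d', P η d → d ≤ d' → P η d')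
    (bdd : ∃ M, ∀ η, 0 < η → η ≤ 1 → P η M) (small : ∀ ε > 0, ∀ᶠ η in 𝓝[>] (0 : ℝ), P η ε) :
    ∃ δ : ℝ → ℝ, Tendsto δ (𝓝[>] 0) (𝓝 0) ∧ ∀ η, 0 < η → η ≤ 1 → P η (δ η) := by
  -- The infimum need not be attained; the extra `η` leaves room and still tends to 0.
  refine ⟨fun η => sInf {d | 0 ≤ d ∧ P η d} + η, ?_, fun η h0 h1 => ?_⟩
  · have hinf : Tendsto (fun η => sInf {d | 0 ≤ d ∧ P η d}) (𝓝[>] (0 : ℝ)) (𝓝 0) := by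
      rw [tendsto_order]
      refine ⟨fun a ha => Eventually.of_forall fun η =>
        ha.trans_le (Real.sInf_nonneg fun d hd => hd.1), fun a ha => ?_⟩
      filter_upwards [small (a / 2) (half_pos ha)] with η hη
      have : sInf {d | 0 ≤ d ∧ P η d} ≤ a / 2 := csInf_le ⟨0, fun d hd => hd.1⟩ ⟨by positivity, hη⟩
      linarith
    simpa using hinf.add (tendsto_nhdsWithin_of_tendsto_nhds (tendsto_id (α := ℝ)))
  · obtain ⟨M, hM⟩ := bdd
    have hne : {d | 0 ≤ d ∧ P η d}.Nonempty :=
      ⟨max M 0, le_max_right _ _, mono _ _ _ (hM η h0 h1) (le_max_left _ _)⟩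
    obtain ⟨d, hd, hlt⟩ := exists_lt_of_csInf_lt hne
      (show sInf {d | 0 ≤ d ∧ P η d} < sInf {d | 0 ≤ d ∧ P η d} + η by linarith)
    exact mono _ _ _ hd.2 hlt.le

theorem continuous_densifyErr (s : ℕ) : Continuous (densifyErr s) := by
  unfold densifyErr
  have := continuous_vonNeumannErr s
  fun_prop

theorem densifyErr_zero (s : ℕ) : densifyErr s 0 = 0 := by
  simp [densifyErr, vonNeumannErr_zero]

theorem continuous_countErr (k : ℕ) : Continuous fun p : ℝ × ℝ => countErr p.1 p.2 k := by
  induction k with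
  | zero => exact continuous_fst
  | succ k ih => simp only [countErr]; fun_prop

theorem countErr_zero (k : ℕ) : countErr 0 0 k = 0 := by
  induction k with
  | zero => rfl
  | succ k ih => simp [countErr, ih]

end Rate

/-! ### From cut norm to box norm -/

section Transference

variable {V : Type*} [Fintype V] {s ℓ : ℕ}

theorem boxForm_const_mul (c : ℝ) (G : (Fin s → V) → ℝ) :
    boxForm ℓ (fun _ v => c * G v) = c ^ ℓ ^ s * boxForm ℓ (fun _ => G) := by
  simp only [boxForm, Finset.mul_expect]
  refine Finset.expect_congr rfl fun x _ => ?_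
  simp [Finset.prod_mul_distrib]

theorem boxNorm_le_of_abs_boxForm_le {G : (Fin s → V) → ℝ} {d : ℝ} (hd : 0 ≤ d)
    (h : |boxForm 2 (fun _ => G)| ≤ d ^ 2 ^ s) : boxNorm G ≤ d := by
  rw [boxNorm, lBoxNorm_eq]
  refine (le_abs_self _).trans ((Real.abs_rpow_le_abs_rpow _ _).trans ?_)
  refine (Real.rpow_le_rpow (abs_nonneg _) h (by positivity)).trans (le_of_eq ?_)
  rw [← Real.rpow_natCast, ← Real.rpow_mul hd]
  push_cast
  rw [mul_one_div_cancel (by positivity), Real.rpow_one]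

variable [Nonempty V]

/-- The majorant `(ν + 1) / 2` of `(F - H) / 2` differs from 1 by `(ν - 1) / 2`, so it inherits the
hypothesis on `ν`. -/
theorem lBoxNorm_four_half_le (hs : 0 < s) (G : (Fin s → V) → ℝ) :
    lBoxNorm 4 (fun v => 2⁻¹ * G v) ≤ lBoxNorm 4 G := by
  have h0 := boxForm_four_const_nonneg hs G
  rw [lBoxNorm_eq, lBoxNorm_eq, boxForm_const_mul]
  refine Real.rpow_le_rpow (by positivity) ?_ (by positivity)
  exact mul_le_of_le_one_left h0 (pow_le_one₀ (by norm_num) (by norm_num))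

variable {ν F : (Fin s → V) → ℝ} {η : ℝ}

/-- A crude bound valid for all `η ≤ 1`: with `H = 0` it keeps the rate finite where `η` is not
small. -/
theorem abs_boxForm_two_const_le (hs : 0 < s) (hη : 0 < η) (hη1 : η ≤ 1)
    (hν : lBoxNorm 4 (fun v => ν v - 1) ≤ η) (hF : ∀ v, |F v| ≤ ν v) :
    |boxForm 2 (fun _ => F)| ≤ 1 + linearFormsConst s := by
  have h1 := abs_expect_dualPairFamily_sub_one_le (g := ν) (a := fun _ => ν) (b := 1) hs hη hη1 hν
    (Or.inr rfl) (fun _ => Or.inr rfl) (fun _ => Or.inl rfl)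
  simp only [boxDual_one, Pi.one_apply, mul_one] at h1
  have h2 : |boxForm 2 (fun _ => F)| ≤ 𝔼 x, ν x * boxDual (fun _ => ν) x := by
    rw [boxForm_two_eq]
    refine (Finset.abs_expect_le _ _).trans (Finset.expect_le_expect fun x _ => ?_)
    rw [abs_mul]
    exact mul_le_mul (hF x) (abs_boxDual_le (fun _ _ => hF) x) (abs_nonneg _)
      ((abs_nonneg _).trans (hF x))
  have h3 : linearFormsConst s * η ≤ linearFormsConst s :=
    mul_le_of_le_one_right (linearFormsConst_pos s).le hη1
  linarith [(abs_le.1 h1).2]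

/-- Closeness in cut norm to a bounded function implies closeness in box norm. -/
theorem boxNorm_sub_le_of_cut (hs : 0 < s) (hη : 0 < η) (hη1 : η ≤ 1)
    (hCη : linearFormsConst s * η ≤ 1) (hν : lBoxNorm 4 (fun v => ν v - 1) ≤ η)
    (hF : ∀ v, |F v| ≤ ν v) {H : (Fin s → V) → ℝ} (hH : ∀ v, H v ∈ Set.Icc (-1 : ℝ) 1) {ε d : ℝ}
    (hε : ∀ φ ∈ cutFunctions V s, |𝔼 v, (F v - H v) * φ v| ≤ ε) (hd : 0 ≤ d)
    (hc : countErr ε (densifyErr s (linearFormsConst s * η)) (2 ^ s - 1) ≤ (d / 2) ^ 2 ^ s) :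
    boxNorm (fun v => F v - H v) ≤ d := by
  have hν' : lBoxNorm 4 (fun v => 2⁻¹ * (ν v + 1) - 1) ≤ η := by
    refine le_trans (le_of_eq ?_) ((lBoxNorm_four_half_le hs fun v => ν v - 1).trans hν)
    congr 1
    funext v
    ring
  have h := abs_boxForm_two_le_countErr hs hη hη1 hCη hν' (f := fun v => 2⁻¹ * (F v - H v))
    (fun v => by
      rw [abs_mul, abs_of_pos (by norm_num : (0 : ℝ) < 2⁻¹)]
      refine mul_le_mul_of_nonneg_left ((abs_sub _ _).trans ?_) (by norm_num)
      exact add_le_add (hF v) (abs_le.2 (hH v)))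
    (ε := ε)
    (fun φ hφ => by
      simp only [mul_assoc]
      rw [← Finset.mul_expect, abs_mul, abs_of_pos (by norm_num : (0 : ℝ) < 2⁻¹)]
      have := hε φ hφ
      linarith [abs_nonneg (𝔼 v, (F v - H v) * φ v)])
    -- All `2 ^ s` vertices carry `f`, and the last copy needs no densification step.
    (2 ^ s - 1) Finset.univ (fun _ v => 2⁻¹ * (F v - H v))
    (by
      rw [Nat.sub_add_cancel Nat.one_le_two_pow]
      simp)
    (fun _ _ => rfl) (by simp)
  refine boxNorm_le_of_abs_boxForm_le hd ?_
  rw [boxForm_const_mul, abs_mul, abs_of_pos (by positivity)] at h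
  have h' := h.trans hc
  rw [div_pow, inv_pow, inv_mul_le_iff₀ (by positivity)] at h'
  refine h'.trans (le_of_eq ?_)
  field_simp

end Transference

/-! ### The main theorem -/

theorem corollary4p5 (s : ℕ) (hs : 2 ≤ s) :
    ∃ δ : ℝ → ℝ, Tendsto δ (𝓝[>] 0) (𝓝 0) ∧
      ∀ (V : Type u) [Fintype V] [Nonempty V] (η : ℝ), 0 < η → η ≤ 1 →
        ∀ ν : (Fin s → V) → ℝ, (∀ v, 0 ≤ ν v) →
          lBoxNorm 4 (fun v => ν v - 1) ≤ η →
            ∀ F : (Fin s → V) → ℝ, (∀ v, |F v| ≤ ν v) →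
              ∃ H : (Fin s → V) → ℝ,
                (∀ v, H v ∈ Set.Icc (-1 : ℝ) 1) ∧
                boxNorm (fun v => F v - H v) ≤ δ η ∧
                ((∀ v, 0 ≤ F v) → ∀ v, 0 ≤ H v) := by
  have hs0 : 0 < s := by omega
  have hC := linearFormsConst_pos s
  obtain ⟨δ, hδ, hP⟩ := exists_rate (P := fun η d => 0 < η → η ≤ 1 →
    ∀ (V : Type u) [Fintype V] [Nonempty V] (ν : (Fin s → V) → ℝ),
      lBoxNorm 4 (fun v => ν v - 1) ≤ η → ∀ F : (Fin s → V) → ℝ, (∀ v, |F v| ≤ ν v) →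
        ∃ H : (Fin s → V) → ℝ, (∀ v, H v ∈ Set.Icc (-1 : ℝ) 1) ∧
          boxNorm (fun v => F v - H v) ≤ d ∧ ((∀ v, 0 ≤ F v) → ∀ v, 0 ≤ H v))
    (fun η d d' h hd h0 h1 V _ _ ν hν F hF => by
      obtain ⟨H, hH1, hH2, hH3⟩ := h h0 h1 V ν hν F hF
      exact ⟨H, hH1, hH2.trans hd, hH3⟩)
    ⟨1 + linearFormsConst s, fun η h0 h1 _ _ V _ _ ν hν F hF => by
      refine ⟨0, by simp, boxNorm_le_of_abs_boxForm_le (by positivity) ?_, by simp⟩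
      simp only [Pi.zero_apply, sub_zero]
      refine (abs_boxForm_two_const_le hs0 h0 h1 hν hF).trans ?_
      exact le_self_pow₀ (by linarith) (by positivity)⟩
    -- Choose `ρ` by continuity of `countErr` at the origin, then `ε'` from the dense model theorem
    -- at `ρ / 2`, then `η` small; `ε'` does not depend on `V`.
    (fun ε hε => by
      have hcount : ∀ᶠ p : ℝ × ℝ in 𝓝 (0, 0), countErr p.1 p.2 (2 ^ s - 1) < (ε / 2) ^ 2 ^ s := by
        refine ((continuous_countErr (2 ^ s - 1)).tendsto (0, 0)).eventually_lt_const ?_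
        simp only [countErr_zero]
        positivity
      obtain ⟨ρ, hρ, hcount⟩ := Metric.eventually_nhds_iff.1 hcount
      obtain ⟨ε', hε', hdense⟩ := exists_denseModel.{u} (half_pos hρ)
      have lin : Tendsto (fun η : ℝ => linearFormsConst s * η) (𝓝[>] 0) (𝓝 0) := by
        refine tendsto_nhdsWithin_of_tendsto_nhds ?_
        simpa using (continuous_const_mul (linearFormsConst s)).tendsto 0
      have e1 := lin.eventually_lt_const one_pos
      have e2 := (((continuous_vonNeumannErr s).tendsto 0).comp lin).eventually_lt_const
        (u := ε') (by rwa [vonNeumannErr_zero])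
      have e3 := (((continuous_densifyErr s).tendsto 0).comp lin).eventually
        (Metric.ball_mem_nhds _ hρ)
      filter_upwards [e1, e2, e3] with η h1 h2 h3 hη0 hη1 V _ _ ν hν F hF
      obtain ⟨H, hH1, hH2, hH3⟩ := hdense (Fin s → V) (cutFunctions V s) ν F
        (fun φ hφ => abs_le_one_of_mem_cutFunctions hφ)
        (fun φ hφ => neg_mem_cutFunctions hs0 hφ) hF
        (fun φ hφ => (abs_expect_sub_one_mul_cutFunction_le hs0 hη0 hη1 h1.le hν hφ).trans h2.le)
      refine ⟨H, hH1, boxNorm_sub_le_of_cut hs0 hη0 hη1 h1.le hν hF hH1 hH2 hε.le ?_, hH3⟩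
      refine (hcount (y := (ρ / 2, _)) ?_).le
      rw [Prod.dist_eq, max_lt_iff]
      refine ⟨?_, ?_⟩
      · rw [Real.dist_eq, sub_zero, abs_of_pos (half_pos hρ)]
        exact half_lt_self hρ
      · rw [densifyErr_zero] at h3
        exact h3)
  exact ⟨δ, hδ, fun V _ _ η h0 h1 ν _ hν F hF => hP η h0 h1 h0 h1 V ν hν F hF⟩
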